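/- Notation. $\preceq$ is the product order on $\mathbb{N}^2$, $\underline t^{\beta}=t_1^{\beta_1}t_2^{\beta_2}$, and $\mathbb{C}\{\cdot\}$ denotes rings of convergent power series. Quasi-ordinary parameterizations. Let $f\in\mathbb{C}\{X_1,X_2\}[X_3]$ be an irreducible Weierstrass polynomial of degree $n$ in $X_3$ whose discriminant is a monomial in $X_1,X_2$ times a unit of $\mathbb{C}\{X_1,X_2\}$. If $S\in\mathbb{C}\{t_1,t_2\}$ satisfies $f(t_1^n,t_2^n,S(\underline t))=0$, then $H=(t_1^n,t_2^n,S(\underline t))$ is called a quasi-ordinary (q.o.) parameterization. The difference of two distinct roots $\xi,\xi'\in\mathbb{C}\{t_1,t_2\}$ of $f(t_1^n,t_2^n,\cdot)$ has the form $\underline t^{\lambda}$ times a unit; the exponents $\lambda\in\mathbb{N}^2$ so obtained are the generalized characteristic exponents, and $\lambda_1=(\lambda_{11},\lambda_{12})$ denotes the smallest of them with respect to $\preceq$. The associated semigroup $\Gamma\subset\mathbb{N}^2$ of $H$ is the set of dominant exponents of the series $h(t_1^n,t_2^n,S(\underline t))$, $h\in\mathbb{C}\{X_1,X_2,X_3\}$,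 that have one; here $q\neq 0$ has dominant exponent $\gamma$ if $\gamma$ is the only vertex of its Newton polyhedron, the convex hull of $\mathrm{supp}(q)+\mathbb{R}_{\ge 0}^2$. The group $\widetilde{\mathcal A}$. It consists of the pairs $(\sigma,\rho)$ of germs of analytic isomorphisms of $(\mathbb{C}^3,0)$ and $(\mathbb{C}^2,0)$ such that, for $i=1,2$, $$\rho_i=t_i(c_i+\zeta_i),\qquad \sigma_i=a_iX_i+X_i\epsilon_i+X_3\eta_i,\qquad \sigma_3=a_3X_3+X_3\epsilon_3+X_1^{\lceil\lambda_{11}/n\rceil}X_2^{\lceil\lambda_{12}/n\rceil}\eta_3,$$ where $c_i,a_i,a_3\in\mathbb{C}\setminus\{0\}$, the convergent power series $\zeta_i$ in $t_1,t_2$ and $\epsilon_i,\epsilon_3$ in $X_1,X_2,X_3$ vanish at the origin, $\eta_i,\eta_3\in\mathbb{C}\{X_1,X_2,X_3\}$, and $\eta_i=0$ if $n>\lambda_{1i}$. Two map germs $H,H'$ are $\widetilde{\mathcal A}$-equivalent if $H'=\sigma\circ H\circ\rho^{-1}$ for some $(\sigma,\rho)\in\widetilde{\mathcal A}$. Eliminable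 terms. Let $H=(t_1^n,t_2^n,\sum_\beta b_\beta\underline t^\beta)$ be a q.o. parameterization with smallest generalized characteristic exponent $\lambda_1$. The term $\underline t^{\kappa}$ is eliminable (by the $\widetilde{\mathcal A}$-action) if there is a q.o. parameterization $H'=(t_1^n,t_2^n,\sum_\beta c_\beta\underline t^\beta)$, with the same smallest generalized characteristic exponent $\lambda_1$, that is $\widetilde{\mathcal A}$-equivalent to $H$ and satisfies $c_{\kappa}=0$ and $c_\beta=b_\beta$ for all $\beta$ except possibly $\beta=\kappa$ and those with $\beta\succ\kappa$. Statement. Let $H=\left(t_1^n,t_2^n,\underline t^{\lambda_1}+a\,\underline t^{\delta}u(\underline t)\right)$ be a q.o. parameterization with smallest generalized characteristic exponent $\lambda_1$ and associated semigroup $\Gamma$, where $a\in\mathbb{C}\setminus\{0\}$, $\delta\in\mathbb{N}^2$, and $u\in\mathbb{C}\{t_1,t_2\}$ with $u(\underline 0)=1$. Then $\underline t^{\delta+\gamma}$ is eliminable by the $\widetilde{\mathcal A}$-action for every $\gamma\in\Gamma\setminus\{(0,0)\}$. -/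

import Mathlib

open scoped Polynomial

noncomputable section

namespace QuasiOrdinary

/-- A power series in `r` variables is convergent if it converges absolutely on some polydisc of
positive radius around the origin. -/
def IsConvergent {r : ℕ} (f : MvPowerSeries (Fin r) ℂ) : Prop :=
  ∃ R : ℝ, 0 < R ∧ Summable fun m : Fin r →₀ ℕ => ‖MvPowerSeries.coeff m f‖ * R ^ m.degree

theorem summable_of_le {r : ℕ} {f : MvPowerSeries (Fin r) ℂ} {R R' : ℝ} (h0 : 0 < R) (h : R ≤ R')
    (hf : Summable fun m : Fin r →₀ ℕ => ‖MvPowerSeries.coeff m f‖ * R' ^ m.degree) :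
    Summable fun m : Fin r →₀ ℕ => ‖MvPowerSeries.coeff m f‖ * R ^ m.degree :=
  Summable.of_nonneg_of_le (fun _ => by positivity) (fun _ => by gcongr) hf

theorem IsConvergent.common {r : ℕ} {f g : MvPowerSeries (Fin r) ℂ} (hf : IsConvergent f)
    (hg : IsConvergent g) : ∃ R : ℝ, 0 < R ∧
      (Summable fun m : Fin r →₀ ℕ => ‖MvPowerSeries.coeff m f‖ * R ^ m.degree) ∧
      (Summable fun m : Fin r →₀ ℕ => ‖MvPowerSeries.coeff m g‖ * R ^ m.degree) := by
  obtain ⟨R₁, h₁, hf⟩ := hf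
  obtain ⟨R₂, h₂, hg⟩ := hg
  exact ⟨min R₁ R₂, lt_min h₁ h₂, summable_of_le (lt_min h₁ h₂) (min_le_left _ _) hf,
    summable_of_le (lt_min h₁ h₂) (min_le_right _ _) hg⟩

theorem IsConvergent.add {r : ℕ} {f g : MvPowerSeries (Fin r) ℂ} (hf : IsConvergent f)
    (hg : IsConvergent g) : IsConvergent (f + g) := by
  obtain ⟨R, hR, hf, hg⟩ := hf.common hg
  refine ⟨R, hR, Summable.of_nonneg_of_le (fun _ => by positivity) (fun m => ?_) (hf.add hg)⟩
  rw [map_add, ← add_mul]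
  gcongr
  exact norm_add_le _ _

theorem norm_coeff_mul_le {r : ℕ} (f g : MvPowerSeries (Fin r) ℂ) {R : ℝ} (hR : 0 ≤ R)
    (m : Fin r →₀ ℕ) :
    ‖MvPowerSeries.coeff m (f * g)‖ * R ^ m.degree ≤
      ∑ p ∈ Finset.HasAntidiagonal.antidiagonal m, (‖MvPowerSeries.coeff p.1 f‖ * R ^ p.1.degree) *
        (‖MvPowerSeries.coeff p.2 g‖ * R ^ p.2.degree) := by
  rw [MvPowerSeries.coeff_mul]
  refine (mul_le_mul_of_nonneg_right (norm_sum_le _ _) (pow_nonneg hR _)).trans (le_of_eq ?_)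
  rw [Finset.sum_mul]
  refine Finset.sum_congr rfl fun p hp => ?_
  rw [← Finset.HasAntidiagonal.mem_antidiagonal.1 hp, map_add, pow_add, norm_mul]
  exact mul_mul_mul_comm _ _ _ _

theorem IsConvergent.mul {r : ℕ} {f g : MvPowerSeries (Fin r) ℂ} (hf : IsConvergent f)
    (hg : IsConvergent g) : IsConvergent (f * g) := by
  obtain ⟨R, hR, hf, hg⟩ := hf.common hg
  have nonneg : ∀ h : MvPowerSeries (Fin r) ℂ,
      0 ≤ fun m : Fin r →₀ ℕ => ‖MvPowerSeries.coeff m h‖ * R ^ m.degree :=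
    fun h m => mul_nonneg (norm_nonneg _) (pow_nonneg hR.le _)
  have h := hf.mul_of_nonneg hg (nonneg f) (nonneg g)
  have h' := summable_sum_mul_antidiagonal_of_summable_mul
    (f := fun m : Fin r →₀ ℕ => ‖MvPowerSeries.coeff m f‖ * R ^ m.degree)
    (g := fun m : Fin r →₀ ℕ => ‖MvPowerSeries.coeff m g‖ * R ^ m.degree) h
  exact ⟨R, hR, Summable.of_nonneg_of_le (nonneg (f * g)) (norm_coeff_mul_le f g hR.le) h'⟩

theorem isConvergent_algebraMap {r : ℕ} (c : ℂ) :
    IsConvergent (algebraMap ℂ (MvPowerSeries (Fin r) ℂ) c) := by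
  classical
  refine ⟨1, one_pos, summable_of_ne_finset_zero (s := {0}) fun m hm => ?_⟩
  have : m ≠ 0 := by simpa using hm
  simp [MvPowerSeries.algebraMap_apply, MvPowerSeries.coeff_C, this]

/-- The ring `ℂ{X₁, …, X_r}` of convergent power series. -/
def ConvSeries (r : ℕ) : Subalgebra ℂ (MvPowerSeries (Fin r) ℂ) where
  carrier := {f | IsConvergent f}
  mul_mem' := IsConvergent.mul
  add_mem' := IsConvergent.add
  algebraMap_mem' := isConvergent_algebraMap

/-- `f ∈ ℂ{X}[Y]` is an irreducible quasi-ordinary Weierstrass polynomial of degree `n`: it is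
monic of degree `n`, its other coefficients vanish at the origin, it is irreducible, and its
discriminant is a monomial times a unit of `ℂ{X}`. -/
structure IsQOPolynomial {r : ℕ} (n : ℕ) (f : (ConvSeries r)[X]) : Prop where
  monic : f.Monic
  natDegree_eq : f.natDegree = n
  weierstrass : ∀ k < n, MvPowerSeries.constantCoeff (f.coeff k : MvPowerSeries (Fin r) ℂ) = 0
  irreducible : Irreducible f
  discr_eq : ∃ (α : Fin r →₀ ℕ) (u : MvPowerSeries (Fin r) ℂ), IsConvergent u ∧
    MvPowerSeries.constantCoeff u ≠ 0 ∧
    (f.discr : MvPowerSeries (Fin r) ℂ) = MvPowerSeries.monomial α (1 : ℂ) * u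

/-- `S(t)` is a convergent root of `f`, where `tᵢ = Xᵢ^{1/n}`; that is,
`f(t₁ⁿ, …, t_rⁿ, S(t)) = 0`. -/
def IsBranch {r : ℕ} (n : ℕ) (f : (ConvSeries r)[X]) (S : MvPowerSeries (Fin r) ℂ) : Prop :=
  IsConvergent S ∧
  ∑ k ∈ Finset.range (f.natDegree + 1),
    MvPowerSeries.subst (fun i : Fin r => (MvPowerSeries.X i : MvPowerSeries (Fin r) ℂ) ^ n)
      (f.coeff k : MvPowerSeries (Fin r) ℂ) * S ^ k = 0

/-- The generalized characteristic exponents of `f`: the `λ ∈ ℕ^r` such that `ξ - ξ' = t^λ u` with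
`u(0) ≠ 0` for two roots `ξ`, `ξ'` of `f`. -/
def charExponents {r : ℕ} (n : ℕ) (f : (ConvSeries r)[X]) : Set (Fin r →₀ ℕ) :=
  {lam | ∃ ξ ξ' u : MvPowerSeries (Fin r) ℂ, IsBranch n f ξ ∧ IsBranch n f ξ' ∧
    IsConvergent u ∧ MvPowerSeries.constantCoeff u ≠ 0 ∧
    ξ - ξ' = MvPowerSeries.monomial lam (1 : ℂ) * u}

/-- `(t₁ⁿ, …, t_rⁿ, S(t))` is a quasi-ordinary parameterization (of an irreducible quasi-ordinary
hypersurface given by a Weierstrass polynomial of degree `n`) whose first, that is smallest,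
generalized characteristic exponent is `lam`. -/
def IsQOParam {r : ℕ} (n : ℕ) (lam : Fin r →₀ ℕ) (S : MvPowerSeries (Fin r) ℂ) : Prop :=
  ∃ f : (ConvSeries r)[X], IsQOPolynomial n f ∧ IsBranch n f S ∧ IsLeast (charExponents n f) lam

/-- The map germ `(t₁ⁿ, …, t_rⁿ, S(t))`. -/
def param {r : ℕ} (n : ℕ) (S : MvPowerSeries (Fin r) ℂ) : Fin (r + 1) → MvPowerSeries (Fin r) ℂ :=
  Fin.snoc (α := fun _ => MvPowerSeries (Fin r) ℂ) (fun i => MvPowerSeries.X i ^ n) S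

/-- The Newton polyhedron of `q`: the convex hull of `supp(q) + ℝ^r_{≥0}`. -/
def newtonPolyhedron {r : ℕ} (q : MvPowerSeries (Fin r) ℂ) : Set (Fin r → ℝ) :=
  convexHull ℝ {x | ∃ m : Fin r →₀ ℕ, MvPowerSeries.coeff m q ≠ 0 ∧ ∀ i, (m i : ℝ) ≤ x i}

/-- `q` has dominant exponent `γ`: `γ` is the only vertex of the Newton polyhedron of `q`. -/
def HasDominantExponent {r : ℕ} (q : MvPowerSeries (Fin r) ℂ) (γ : Fin r →₀ ℕ) : Prop :=
  (newtonPolyhedron q).extremePoints ℝ = {fun i => (γ i : ℝ)}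

/-- The associated semigroup `Γ_H` of `H = (t₁ⁿ, …, t_rⁿ, S(t))`: the set of the dominant exponents
of the elements `H^*(h) = h(t₁ⁿ, …, t_rⁿ, S(t))`, `h ∈ ℂ{X₁, …, X_{r+1}}`, that have one. -/
def assocSemigroup {r : ℕ} (n : ℕ) (S : MvPowerSeries (Fin r) ℂ) : Set (Fin r →₀ ℕ) :=
  {γ | ∃ h : MvPowerSeries (Fin (r + 1)) ℂ, IsConvergent h ∧
    HasDominantExponent (MvPowerSeries.subst (param n S) h) γ}

/-- A tuple of `k` convergent power series in `k` variables that is an analytic isomorphism of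
`(ℂ^k, 0)`: it maps the origin to itself and has a two-sided inverse of the same kind. -/
def IsGermIso {k : ℕ} (φ : Fin k → MvPowerSeries (Fin k) ℂ) : Prop :=
  (∀ i, IsConvergent (φ i) ∧ MvPowerSeries.constantCoeff (φ i) = 0) ∧
  ∃ ψ : Fin k → MvPowerSeries (Fin k) ℂ,
    (∀ i, IsConvergent (ψ i) ∧ MvPowerSeries.constantCoeff (ψ i) = 0) ∧
    (∀ i, MvPowerSeries.subst ψ (φ i) = MvPowerSeries.X i) ∧
    (∀ i, MvPowerSeries.subst φ (ψ i) = MvPowerSeries.X i)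

/-- Membership of `(σ, ρ)` in the group `𝒜̃` of the topological class with degree `n` and first
generalized characteristic exponent `lam`. The variables `X₁, …, X_r` are indexed by
`Fin.castSucc i` with `i : Fin r`, and `X_{r+1}` by `Fin.last r`. -/
structure MemATilde {r : ℕ} (n : ℕ) (lam : Fin r →₀ ℕ)
    (σ : Fin (r + 1) → MvPowerSeries (Fin (r + 1)) ℂ)
    (ρ : Fin r → MvPowerSeries (Fin r) ℂ) : Prop where
  iso_left : IsGermIso σ
  iso_right : IsGermIso ρ
  right_eq : ∀ i : Fin r, ∃ (c : ℂ) (ζ : MvPowerSeries (Fin r) ℂ), c ≠ 0 ∧ IsConvergent ζ ∧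
    MvPowerSeries.constantCoeff ζ = 0 ∧ ρ i = MvPowerSeries.X i * (MvPowerSeries.C c + ζ)
  left_eq : ∀ i : Fin r, ∃ (a : ℂ) (ε η : MvPowerSeries (Fin (r + 1)) ℂ), a ≠ 0 ∧
    IsConvergent ε ∧ MvPowerSeries.constantCoeff ε = 0 ∧ IsConvergent η ∧ (lam i < n → η = 0) ∧
    σ i.castSucc = MvPowerSeries.C a * MvPowerSeries.X i.castSucc +
      (MvPowerSeries.X i.castSucc * ε + MvPowerSeries.X (Fin.last r) * η)
  left_last_eq : ∃ (a : ℂ) (ε η : MvPowerSeries (Fin (r + 1)) ℂ), a ≠ 0 ∧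
    IsConvergent ε ∧ MvPowerSeries.constantCoeff ε = 0 ∧ IsConvergent η ∧
    σ (Fin.last r) = MvPowerSeries.C a * MvPowerSeries.X (Fin.last r) +
      (MvPowerSeries.X (Fin.last r) * ε +
        (∏ i : Fin r, MvPowerSeries.X i.castSucc ^ ⌈(lam i : ℚ) / n⌉₊) * η)

/-- `𝒜̃`-equivalence of two map germs `(ℂ^r, 0) → (ℂ^{r+1}, 0)`: `H' = σ ∘ H ∘ ρ⁻¹` for some
`(σ, ρ) ∈ 𝒜̃`, written as `σ ∘ H = H' ∘ ρ`. -/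
def ATildeEquiv {r : ℕ} (n : ℕ) (lam : Fin r →₀ ℕ)
    (H H' : Fin (r + 1) → MvPowerSeries (Fin r) ℂ) : Prop :=
  ∃ (σ : Fin (r + 1) → MvPowerSeries (Fin (r + 1)) ℂ) (ρ : Fin r → MvPowerSeries (Fin r) ℂ),
    MemATilde n lam σ ρ ∧
    ∀ j, MvPowerSeries.subst H (σ j) = MvPowerSeries.subst ρ (H' j)

/-- The term `t^γ` of `H = (t₁ⁿ, …, t_rⁿ, S)` is eliminable by the `𝒜̃`-action: some
quasi-ordinary parameterization `H' = (t₁ⁿ, …, t_rⁿ, S')` that is `𝒜̃`-equivalent to `H` has no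
term `t^γ`, and `S'` and `S` have the same coefficients except possibly at `γ` and at the exponents
`β ≻ γ`. (So if all exponents of `S`, as well as `γ`, are `⪰ lam`, then so are those of `S'`.) -/
def IsEliminable {r : ℕ} (n : ℕ) (lam : Fin r →₀ ℕ) (S : MvPowerSeries (Fin r) ℂ)
    (γ : Fin r →₀ ℕ) : Prop :=
  ∃ S' : MvPowerSeries (Fin r) ℂ, IsQOParam n lam S' ∧
    ATildeEquiv n lam (param n S) (param n S') ∧
    MvPowerSeries.coeff γ S' = 0 ∧
    ∀ β, β ≠ γ → ¬ γ < β → MvPowerSeries.coeff β S' = MvPowerSeries.coeff β S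

end QuasiOrdinary

end

/-! Let `q` be the pullback of some `h` with dominant exponent `γ ≠ 0`, and put `Θ = 1 + c q`, `θ =
1 + c h`. The change `t_j ↦ t_j Θ^w` of the source and the change `X_j ↦ X_j θ^(n w)`, `X_(r+1) ↦
X_(r+1) θ^k` of the target form an element of the group. They carry `S` to the series `S'` whose
pullback under the source change is `S Θ^k`. If `lam ≠ δ`, choose `j` with `lam j ≠ δ j` and take `w
= 1`, `k = lam j`. The monomial `t^lam` is then fixed exactly, while `t^δ u` is multiplied, modulo
exponents strictly above `δ + γ`, by `1 + (lam j - δ j) c v t^γ`, where `v` is the coefficient of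
`q` at `γ`. A suitable `c` kills the coefficient at `δ + γ`. If `lam = δ`, then `S` is a monomial
times a unit, and `w = 0`, `k = 1` suffices. These are `isEliminable_of_ne` and
`isEliminable_of_eq_monomial_mul`.

Two points need more than this computation. First, `S'` must again be quasi-ordinary with the same
`lam`. By `isQOParam_iff` the definition is expressed through the differences between `S` and its
conjugates under `n`-th roots of unity. `exists_conj_sub_eq_subst` shows that each difference for
`S'` is the corresponding one for `S` times a unit, after a coordinate change `t_i ↦ t_i · unit`.
The key is that conjugation changes `Θ`, a pullback, only by multiples of the change in `S`.

Second, when `lam ≠ δ`, the fixed monomial `t^lam` must not be the term to be removed. `lam_ne_add`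
excludes `lam = δ + γ` by comparing the characters of roots of unity on `lam`, `δ` and `γ`.

Convergence, including that of the inverse coordinate changes, is controlled by weighted `ℓ¹`-norms.
Two variables matter only in passing from a unique vertex of the Newton polyhedron to a monomial
times a unit. -/

namespace QuasiOrdinary

open Filter Topology
open scoped ENNReal NNReal

/-! ### Weighted norms of power series -/

/-- The weighted `ℓ¹`-norm `∑ ‖f_m‖ R^|m|`, with values in `[0, ∞]`. -/
noncomputable def wnorm {r : ℕ} (R : ℝ≥0∞) (f : MvPowerSeries (Fin r) ℂ) : ℝ≥0∞ :=
  ∑' m : Fin r →₀ ℕ, ‖MvPowerSeries.coeff m f‖ₑ * R ^ m.degree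

theorem wnorm_mono {r : ℕ} {R R' : ℝ≥0∞} (h : R ≤ R') (f : MvPowerSeries (Fin r) ℂ) :
    wnorm R f ≤ wnorm R' f :=
  ENNReal.tsum_le_tsum fun _ => by gcongr

theorem isConvergent_iff_wnorm {r : ℕ} {f : MvPowerSeries (Fin r) ℂ} :
    IsConvergent f ↔ ∃ R : ℝ≥0, 0 < R ∧ wnorm R f ≠ ∞ := by
  have key : ∀ R : ℝ≥0, (wnorm R f ≠ ∞ ↔
      Summable fun m : Fin r →₀ ℕ => ‖MvPowerSeries.coeff m f‖ * (R : ℝ) ^ m.degree) := by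
    intro R
    have h1 : wnorm R f =
        ∑' m : Fin r →₀ ℕ, ((‖MvPowerSeries.coeff m f‖₊ * R ^ m.degree : ℝ≥0) : ℝ≥0∞) := by
      unfold wnorm
      push_cast
      rfl
    rw [h1, ENNReal.tsum_coe_ne_top_iff_summable, ← NNReal.summable_coe]
    rfl
  constructor
  · rintro ⟨R, hR, h⟩
    exact ⟨⟨R, hR.le⟩, hR, (key _).2 h⟩
  · rintro ⟨R, hR, h⟩
    exact ⟨R, hR, (key _).1 h⟩

theorem wnorm_add_le {r : ℕ} (R : ℝ≥0∞) (f g : MvPowerSeries (Fin r) ℂ) :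
    wnorm R (f + g) ≤ wnorm R f + wnorm R g := by
  unfold wnorm
  rw [← ENNReal.tsum_add]
  refine ENNReal.tsum_le_tsum fun m => ?_
  rw [← add_mul, map_add]
  gcongr
  exact enorm_add_le _ _

theorem wnorm_neg {r : ℕ} (R : ℝ≥0∞) (f : MvPowerSeries (Fin r) ℂ) :
    wnorm R (-f) = wnorm R f := by
  simp [wnorm]

theorem wnorm_mul_le {r : ℕ} (R : ℝ≥0∞) (f g : MvPowerSeries (Fin r) ℂ) :
    wnorm R (f * g) ≤ wnorm R f * wnorm R g := by
  classical
  let F : (Fin r →₀ ℕ) × (Fin r →₀ ℕ) → ℝ≥0∞ := fun p =>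
    (‖MvPowerSeries.coeff p.1 f‖ₑ * R ^ p.1.degree) * (‖MvPowerSeries.coeff p.2 g‖ₑ * R ^ p.2.degree)
  have h1 : wnorm R f * wnorm R g = ∑' p, F p := by
    unfold wnorm
    rw [ENNReal.tsum_prod', ← ENNReal.tsum_mul_right]
    simp_rw [← ENNReal.tsum_mul_left]
    rfl
  rw [h1, ← Equiv.tsum_eq Finset.HasAntidiagonal.sigmaAntidiagonalEquivProd F, ENNReal.tsum_sigma']
  refine ENNReal.tsum_le_tsum fun m => ?_
  rw [tsum_fintype, MvPowerSeries.coeff_mul]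
  refine (mul_le_mul_left (enorm_sum_le _ _) _).trans ?_
  rw [Finset.sum_mul, ← Finset.sum_coe_sort (Finset.HasAntidiagonal.antidiagonal m)]
  refine Finset.sum_le_sum fun p _ => ?_
  have hp : p.1.1 + p.1.2 = m := Finset.HasAntidiagonal.mem_antidiagonal.1 p.2
  simp only [F, Finset.HasAntidiagonal.sigmaAntidiagonalEquivProd_apply]
  have hd : m.degree = p.1.1.degree + p.1.2.degree := by rw [← map_add, hp]
  rw [hd, pow_add, enorm_mul]
  exact (mul_mul_mul_comm _ _ _ _).le

theorem wnorm_one {r : ℕ} (R : ℝ≥0∞) : wnorm R (1 : MvPowerSeries (Fin r) ℂ) = 1 := by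
  classical
  unfold wnorm
  rw [tsum_eq_single 0]
  · simp
  · intro m hm
    simp [MvPowerSeries.coeff_one, hm]

theorem wnorm_X {r : ℕ} (R : ℝ≥0∞) (i : Fin r) :
    wnorm R (MvPowerSeries.X i : MvPowerSeries (Fin r) ℂ) = R := by
  classical
  unfold wnorm
  rw [tsum_eq_single (Finsupp.single i 1)]
  · simp [MvPowerSeries.coeff_X]
  · intro m hm
    simp [MvPowerSeries.coeff_X, hm]

theorem wnorm_pow_le {r : ℕ} (R : ℝ≥0∞) (f : MvPowerSeries (Fin r) ℂ) (k : ℕ) :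
    wnorm R (f ^ k) ≤ wnorm R f ^ k := by
  induction k with
  | zero => simp [wnorm_one]
  | succ k ih => exact (wnorm_mul_le R _ _).trans (by rw [pow_succ]; exact mul_le_mul' ih le_rfl)

theorem wnorm_prod_pow_le {r k : ℕ} {R s : ℝ≥0∞} {a : Fin k → MvPowerSeries (Fin r) ℂ}
    (ha : ∀ i, wnorm R (a i) ≤ s) (d : Fin k →₀ ℕ) :
    wnorm R (d.prod fun i e => a i ^ e) ≤ s ^ d.degree := by
  classical
  rw [Finsupp.prod, Finsupp.degree_apply, ← Finset.prod_pow_eq_pow_sum]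
  generalize d.support = t
  induction t using Finset.induction_on with
  | empty => simp [wnorm_one]
  | insert i t hi ih =>
    rw [Finset.prod_insert hi, Finset.prod_insert hi]
    refine (wnorm_mul_le R _ _).trans (mul_le_mul' ?_ ih)
    exact (wnorm_pow_le R _ _).trans (pow_le_pow_left' (ha i) _)

/-- Expand into the products `a^d`, each of norm at most `s^|d|`. Values in `[0, ∞]` allow the two
sums to be exchanged freely. -/
theorem wnorm_subst_le {r k : ℕ} {R s : ℝ≥0∞} {a : Fin k → MvPowerSeries (Fin r) ℂ}
    (hs : MvPowerSeries.HasSubst a) (ha : ∀ i, wnorm R (a i) ≤ s) (f : MvPowerSeries (Fin k) ℂ) :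
    wnorm R (MvPowerSeries.subst a f) ≤ wnorm s f := by
  have h1 : ∀ e : Fin r →₀ ℕ, ‖MvPowerSeries.coeff e (MvPowerSeries.subst a f)‖ₑ ≤
      ∑' d : Fin k →₀ ℕ, ‖MvPowerSeries.coeff d f‖ₑ *
        ‖MvPowerSeries.coeff e (d.prod fun i e => a i ^ e)‖ₑ := by
    intro e
    rw [MvPowerSeries.coeff_subst hs, finsum_eq_sum _ (MvPowerSeries.coeff_subst_finite hs f e)]
    refine (enorm_sum_le _ _).trans ?_
    simp_rw [smul_eq_mul, enorm_mul]
    exact ENNReal.sum_le_tsum _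
  calc wnorm R (MvPowerSeries.subst a f)
      ≤ ∑' e : Fin r →₀ ℕ, ∑' d : Fin k →₀ ℕ, ‖MvPowerSeries.coeff d f‖ₑ *
        (‖MvPowerSeries.coeff e (d.prod fun i e => a i ^ e)‖ₑ * R ^ e.degree) := by
        refine ENNReal.tsum_le_tsum fun e => ?_
        refine (mul_le_mul_left (h1 e) _).trans (le_of_eq ?_)
        rw [← ENNReal.tsum_mul_right]
        simp_rw [mul_assoc]
    _ = ∑' d : Fin k →₀ ℕ, ‖MvPowerSeries.coeff d f‖ₑ *
        wnorm R (d.prod fun i e => a i ^ e) := by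
        rw [ENNReal.tsum_comm]
        simp_rw [ENNReal.tsum_mul_left]
        rfl
    _ ≤ wnorm s f := ENNReal.tsum_le_tsum fun d => by
        gcongr
        exact wnorm_prod_pow_le ha d

/-- Only exponents of positive degree contribute, and for these `c^|m| ≤ c`. Hence the norm becomes
small with the radius, which makes substitution into convergent series possible. -/
theorem wnorm_mul_radius_le {r : ℕ} {f : MvPowerSeries (Fin r) ℂ}
    (hf : MvPowerSeries.constantCoeff f = 0) {c : ℝ≥0∞} (hc : c ≤ 1) (R : ℝ≥0∞) :
    wnorm (c * R) f ≤ c * wnorm R f := by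
  unfold wnorm
  rw [← ENNReal.tsum_mul_left]
  refine ENNReal.tsum_le_tsum fun m => ?_
  by_cases hm : m = 0
  · subst hm
    simp [hf]
  · have h1 : c ^ m.degree ≤ c := by
      have : m.degree ≠ 0 := by simpa [Finsupp.degree_eq_zero_iff] using hm
      exact pow_le_of_le_one zero_le hc this
    rw [mul_pow, mul_left_comm]
    gcongr

theorem IsConvergent.eventually_wnorm_le {r : ℕ} {f : MvPowerSeries (Fin r) ℂ}
    (hf : IsConvergent f) (hf0 : MvPowerSeries.constantCoeff f = 0) {s : ℝ≥0} (hs : 0 < s) :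
    ∀ᶠ R : ℝ≥0 in 𝓝[>] 0, wnorm R f ≤ s := by
  obtain ⟨R₀, hR₀, h⟩ := isConvergent_iff_wnorm.1 hf
  lift wnorm (R₀ : ℝ≥0∞) f to ℝ≥0 using h with W hW
  set c : ℝ≥0 := min 1 (s / (W + 1)) with hc
  have hcpos : 0 < c := lt_min one_pos (by positivity)
  have hle : wnorm (c * R₀ : ℝ≥0) f ≤ s := by
    rw [ENNReal.coe_mul]
    refine (wnorm_mul_radius_le hf0 (by exact_mod_cast min_le_left _ _) _).trans ?_
    rw [← hW]
    norm_cast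
    calc c * W ≤ s / (W + 1) * (W + 1) := by
          gcongr
          · exact min_le_right _ _
          · exact le_self_add
      _ = s := div_mul_cancel₀ _ (by positivity)
  have hpos : 0 < c * R₀ := by positivity
  filter_upwards [Ioc_mem_nhdsGT hpos] with R hR
  exact (wnorm_mono (by exact_mod_cast hR.2) f).trans hle

theorem IsConvergent.subst {r k : ℕ} {f : MvPowerSeries (Fin k) ℂ} (hf : IsConvergent f)
    {a : Fin k → MvPowerSeries (Fin r) ℂ} (ha : ∀ i, IsConvergent (a i))
    (ha0 : ∀ i, MvPowerSeries.constantCoeff (a i) = 0) :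
    IsConvergent (MvPowerSeries.subst a f) := by
  obtain ⟨s, hs, h⟩ := isConvergent_iff_wnorm.1 hf
  have h1 : ∀ᶠ R : ℝ≥0 in 𝓝[>] 0, ∀ i, wnorm R (a i) ≤ s :=
    eventually_all.2 fun i => (ha i).eventually_wnorm_le (ha0 i) hs
  obtain ⟨R, hR, hRpos⟩ := (h1.and self_mem_nhdsWithin).exists
  refine isConvergent_iff_wnorm.2 ⟨R, hRpos, ne_top_of_le_ne_top h ?_⟩
  exact wnorm_subst_le (MvPowerSeries.hasSubst_of_constantCoeff_zero ha0) hR f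

theorem isConvergent_C {r : ℕ} (c : ℂ) :
    IsConvergent (MvPowerSeries.C c : MvPowerSeries (Fin r) ℂ) :=
  isConvergent_algebraMap c

theorem isConvergent_one {r : ℕ} : IsConvergent (1 : MvPowerSeries (Fin r) ℂ) :=
  (ConvSeries r).one_mem

theorem IsConvergent.pow {r : ℕ} {f : MvPowerSeries (Fin r) ℂ} (hf : IsConvergent f) (k : ℕ) :
    IsConvergent (f ^ k) :=
  (ConvSeries r).pow_mem hf k

theorem IsConvergent.sub {r : ℕ} {f g : MvPowerSeries (Fin r) ℂ} (hf : IsConvergent f)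
    (hg : IsConvergent g) : IsConvergent (f - g) :=
  (ConvSeries r).sub_mem hf hg

theorem isConvergent_X {r : ℕ} (i : Fin r) :
    IsConvergent (MvPowerSeries.X i : MvPowerSeries (Fin r) ℂ) :=
  isConvergent_iff_wnorm.2 ⟨1, one_pos, by simp [wnorm_X]⟩

theorem IsConvergent.of_monomial_mul {r : ℕ} {u : MvPowerSeries (Fin r) ℂ} (m : Fin r →₀ ℕ)
    (h : IsConvergent (MvPowerSeries.monomial m (1 : ℂ) * u)) : IsConvergent u := by
  obtain ⟨R, hR, h⟩ := h
  refine ⟨R, hR, ?_⟩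
  have h1 := (h.comp_injective (add_right_injective m)).mul_left ((R ^ m.degree)⁻¹)
  refine h1.congr fun d => ?_
  simp only [Function.comp_apply, MvPowerSeries.coeff_add_monomial_mul, one_mul, map_add, pow_add]
  field_simp

/-! ### Congruences between substitutions -/

/-- The ideal of the power series whose coefficients vanish on a lower set of exponents. -/
def vanishIdeal {σ : Type*} (T : LowerSet (σ →₀ ℕ)) : Ideal (MvPowerSeries σ ℂ) where
  carrier := {f | ∀ m ∈ T, MvPowerSeries.coeff m f = 0}
  zero_mem' := fun m _ => map_zero _
  add_mem' := fun {f g} hf hg m hm => by rw [map_add, hf m hm, hg m hm, add_zero]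
  smul_mem' := fun c f hf m hm => by
    classical
    rw [smul_eq_mul, MvPowerSeries.coeff_mul]
    refine Finset.sum_eq_zero fun p hp => ?_
    have hp' : p.1 + p.2 = m := Finset.HasAntidiagonal.mem_antidiagonal.1 hp
    rw [hf p.2 (T.lower (hp' ▸ le_add_self) hm), mul_zero]

/-- Each coefficient of a substitution is a finite sum of coefficients of monomials in the
substituted series, and congruences modulo an ideal pass to monomials. -/
theorem subst_sub_subst_mem_vanishIdeal {σ τ : Type*} {T : LowerSet (σ →₀ ℕ)}
    {a b : τ → MvPowerSeries σ ℂ} (ha : MvPowerSeries.HasSubst a) (hb : MvPowerSeries.HasSubst b)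
    (h : ∀ i, a i - b i ∈ vanishIdeal T) (f : MvPowerSeries τ ℂ) :
    MvPowerSeries.subst a f - MvPowerSeries.subst b f ∈ vanishIdeal T := by
  intro m hm
  have key : ∀ d : τ →₀ ℕ, MvPowerSeries.coeff m (d.prod fun i e => a i ^ e) =
      MvPowerSeries.coeff m (d.prod fun i e => b i ^ e) := by
    intro d
    have h1 : (d.prod fun i e => a i ^ e) - (d.prod fun i e => b i ^ e) ∈ vanishIdeal T := by
      rw [← Ideal.Quotient.eq, map_finsuppProd, map_finsuppProd]
      refine Finsupp.prod_congr fun i _ => ?_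
      rw [map_pow, map_pow, Ideal.Quotient.eq.2 (h i)]
    have h2 := h1 m hm
    rwa [map_sub, sub_eq_zero] at h2
  rw [map_sub, sub_eq_zero, MvPowerSeries.coeff_subst ha, MvPowerSeries.coeff_subst hb]
  simp_rw [key]

/-- The Taylor argument is carried out in a universal case. Write `x i = y i + d e i` and replace
`d`, `y i` and the non-constant part of `e i` by independent variables. The constant part of `e i`
is kept apart because only series without constant term may be substituted. -/
theorem dvd_subst_sub_subst {k : ℕ} {σ : Type*} {x y : Fin k → MvPowerSeries σ ℂ}
    (hy : ∀ i, MvPowerSeries.constantCoeff (y i) = 0)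
    {d : MvPowerSeries σ ℂ} (hd : ∀ i, d ∣ x i - y i) (f : MvPowerSeries (Fin k) ℂ) :
    d ∣ MvPowerSeries.subst x f - MvPowerSeries.subst y f := by
  by_cases hd0 : MvPowerSeries.constantCoeff d = 0
  swap
  · exact (MvPowerSeries.isUnit_iff_constantCoeff.2 (isUnit_iff_ne_zero.2 hd0)).dvd
  choose e he using hd
  let τ := Option (Fin k ⊕ Fin k)
  let A : Fin k → MvPowerSeries τ ℂ := fun i => MvPowerSeries.X (some (Sum.inl i)) +
    MvPowerSeries.X none * (MvPowerSeries.X (some (Sum.inr i)) +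
      MvPowerSeries.C (MvPowerSeries.constantCoeff (e i)))
  let A' : Fin k → MvPowerSeries τ ℂ := fun i => MvPowerSeries.X (some (Sum.inl i))
  let B : τ → MvPowerSeries σ ℂ := fun t => match t with
    | none => d
    | some (Sum.inl i) => y i
    | some (Sum.inr i) => e i - MvPowerSeries.C (MvPowerSeries.constantCoeff (e i))
  have hA : MvPowerSeries.HasSubst A :=
    MvPowerSeries.hasSubst_of_constantCoeff_zero fun i => by simp [A]
  have hA' : MvPowerSeries.HasSubst A' :=
    MvPowerSeries.hasSubst_of_constantCoeff_zero fun i => by simp [A']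
  have hB : MvPowerSeries.HasSubst B := by
    refine MvPowerSeries.hasSubst_of_constantCoeff_zero fun t => ?_
    match t with
    | none => exact hd0
    | some (Sum.inl i) => exact hy i
    | some (Sum.inr i) => simp [B]
  -- Divisibility by the variable standing for `d` is membership in the ideal attached to this lower
  -- set, so the congruence lemma applies.
  let T : LowerSet (τ →₀ ℕ) := ⟨{m | m none = 0}, fun m m' hle hm => by
    have := hle none
    simp only [Set.mem_ofPred_eq] at hm ⊢
    omega⟩
  have hT : ∀ g : MvPowerSeries τ ℂ, MvPowerSeries.X none ∣ g ↔ g ∈ vanishIdeal T :=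
    fun g => MvPowerSeries.X_dvd_iff
  have h1 : MvPowerSeries.X none ∣ MvPowerSeries.subst A f - MvPowerSeries.subst A' f := by
    rw [hT]
    refine subst_sub_subst_mem_vanishIdeal hA hA' (fun i => ?_) f
    rw [← hT]
    simp [A, A']
  have h2 := map_dvd (MvPowerSeries.substAlgHom (R := ℂ) hB) h1
  rw [map_sub, MvPowerSeries.substAlgHom_X] at h2
  simp only [MvPowerSeries.substAlgHom_apply] at h2
  rw [MvPowerSeries.subst_comp_subst_apply hA hB, MvPowerSeries.subst_comp_subst_apply hA' hB] at h2
  convert h2 using 3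
  · ext1 i
    simp only [A, ← MvPowerSeries.substAlgHom_apply hB, map_add, map_mul,
      MvPowerSeries.substAlgHom_X]
    rw [MvPowerSeries.substAlgHom_apply hB, MvPowerSeries.subst_C]
    simp only [B, sub_add_cancel]
    rw [← he]
    ring
  · ext1 i
    simp only [A', MvPowerSeries.subst_X hB, B]

/-! ### Inverse function theorem for germs `Xᵢ (1 + eᵢ)` -/

/-- The exponents of total degree less than `d`. -/
def degreeLT (σ : Type*) (d : ℕ) : LowerSet (σ →₀ ℕ) :=
  ⟨{m | m.degree < d}, fun _ _ hle hm => (Finsupp.degree_mono hle).trans_lt hm⟩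

theorem mem_degreeLT {σ : Type*} {d : ℕ} {m : σ →₀ ℕ} : m ∈ degreeLT σ d ↔ m.degree < d := Iff.rfl

theorem vanishIdeal_degreeLT_antitone {σ : Type*} {d d' : ℕ} (h : d ≤ d')
    {f : MvPowerSeries σ ℂ} (hf : f ∈ vanishIdeal (degreeLT σ d')) :
    f ∈ vanishIdeal (degreeLT σ d) :=
  fun m hm => hf m (lt_of_lt_of_le hm h)

theorem mem_vanishIdeal_degreeLT_one {σ : Type*} {f : MvPowerSeries σ ℂ}
    (hf : MvPowerSeries.constantCoeff f = 0) : f ∈ vanishIdeal (degreeLT σ 1) := by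
  intro m hm
  have : m = 0 := by
    rw [mem_degreeLT, Nat.lt_one_iff] at hm
    exact (Finsupp.degree_eq_zero_iff m).1 hm
  rw [this]
  exact hf

theorem mul_mem_vanishIdeal_degreeLT {σ : Type*} {f g : MvPowerSeries σ ℂ} {d d' : ℕ}
    (hf : f ∈ vanishIdeal (degreeLT σ d)) (hg : g ∈ vanishIdeal (degreeLT σ d')) :
    f * g ∈ vanishIdeal (degreeLT σ (d + d')) := by
  classical
  intro m hm
  rw [MvPowerSeries.coeff_mul]
  refine Finset.sum_eq_zero fun p hp => ?_
  have hp' : p.1 + p.2 = m := Finset.HasAntidiagonal.mem_antidiagonal.1 hp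
  rw [mem_degreeLT, ← hp', map_add] at hm
  by_cases h : p.1.degree < d
  · rw [hf p.1 h, zero_mul]
  · rw [hg p.2 (mem_degreeLT.2 (by omega)), mul_zero]

/-- The map whose fixed point is the inverse of `(Xᵢ (1 + eᵢ))ᵢ`. -/
noncomputable def inverseStep {k : ℕ} (e : Fin k → MvPowerSeries (Fin k) ℂ)
    (p : Fin k → MvPowerSeries (Fin k) ℂ) : Fin k → MvPowerSeries (Fin k) ℂ :=
  fun i => MvPowerSeries.X i - p i * MvPowerSeries.subst p (e i)

theorem constantCoeff_inverseStep {k : ℕ} {e p : Fin k → MvPowerSeries (Fin k) ℂ}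
    (hp : ∀ i, MvPowerSeries.constantCoeff (p i) = 0) (i : Fin k) :
    MvPowerSeries.constantCoeff (inverseStep e p i) = 0 := by
  simp [inverseStep, hp]

/-- The step is contracting for the degree filtration: as `e`, `p`, `q` have no constant term, every
error term gains a factor of positive order. -/
theorem inverseStep_congr {k : ℕ} {e p q : Fin k → MvPowerSeries (Fin k) ℂ}
    (he : ∀ i, MvPowerSeries.constantCoeff (e i) = 0)
    (hp : ∀ i, MvPowerSeries.constantCoeff (p i) = 0)
    (hq : ∀ i, MvPowerSeries.constantCoeff (q i) = 0) {d : ℕ}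
    (h : ∀ i, p i - q i ∈ vanishIdeal (degreeLT (Fin k) d)) (i : Fin k) :
    inverseStep e p i - inverseStep e q i ∈ vanishIdeal (degreeLT (Fin k) (d + 1)) := by
  have hp' := MvPowerSeries.hasSubst_of_constantCoeff_zero hp
  have hq' := MvPowerSeries.hasSubst_of_constantCoeff_zero hq
  have h1 := mul_mem_vanishIdeal_degreeLT (h i) (mem_vanishIdeal_degreeLT_one
    (MvPowerSeries.constantCoeff_subst_eq_zero hp' hp (he i)))
  have h2 := mul_mem_vanishIdeal_degreeLT (subst_sub_subst_mem_vanishIdeal hp' hq' h (e i))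
    (mem_vanishIdeal_degreeLT_one (hq i))
  convert neg_mem (add_mem h1 h2) using 1
  simp only [inverseStep]
  ring

theorem wnorm_inverseStep_le {k : ℕ} {e p : Fin k → MvPowerSeries (Fin k) ℂ}
    (hp : ∀ i, MvPowerSeries.constantCoeff (p i) = 0) {R s : ℝ≥0∞}
    (he : ∀ i, wnorm s (e i) ≤ 2⁻¹) (hR : R ≤ s * 2⁻¹) (h : ∀ i, wnorm R (p i) ≤ s) (i : Fin k) :
    wnorm R (inverseStep e p i) ≤ s := by
  have hp' := MvPowerSeries.hasSubst_of_constantCoeff_zero hp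
  calc wnorm R (inverseStep e p i)
      ≤ wnorm R (MvPowerSeries.X i) + wnorm R (p i * MvPowerSeries.subst p (e i)) := by
        rw [inverseStep, sub_eq_add_neg, ← wnorm_neg R (_ * _)]
        exact wnorm_add_le _ _ _
    _ ≤ s * 2⁻¹ + s * 2⁻¹ := by
        refine add_le_add (by rwa [wnorm_X]) ((wnorm_mul_le _ _ _).trans ?_)
        exact mul_le_mul' (h i) ((wnorm_subst_le hp' h _).trans (he i))
    _ = s := by rw [← mul_add, ENNReal.inv_two_add_inv_two, mul_one]

theorem exists_convergent_fixedPoint_inverseStep {k : ℕ} {e : Fin k → MvPowerSeries (Fin k) ℂ}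
    (he : ∀ i, IsConvergent (e i)) (he0 : ∀ i, MvPowerSeries.constantCoeff (e i) = 0) :
    ∃ q : Fin k → MvPowerSeries (Fin k) ℂ, (∀ i, IsConvergent (q i)) ∧
      (∀ i, MvPowerSeries.constantCoeff (q i) = 0) ∧ inverseStep e q = q := by
  let p : ℕ → Fin k → MvPowerSeries (Fin k) ℂ := fun m => (inverseStep e)^[m] 0
  have hsucc : ∀ m, p (m + 1) = inverseStep e (p m) := fun m => Function.iterate_succ_apply' _ _ _
  have hp0 : ∀ m i, MvPowerSeries.constantCoeff (p m i) = 0 := by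
    intro m
    induction m with
    | zero => simp [p]
    | succ m ih => rw [hsucc]; exact constantCoeff_inverseStep ih
  have hstep : ∀ m i, p (m + 1) i - p m i ∈ vanishIdeal (degreeLT (Fin k) m) := by
    intro m
    induction m with
    | zero => exact fun i n hn => absurd hn (Nat.not_lt_zero _)
    | succ m ih =>
      intro i
      have := inverseStep_congr he0 (hp0 (m + 1)) (hp0 m) ih i
      rwa [← hsucc, ← hsucc] at this
  have hstable : ∀ m d i, p (m + d) i - p m i ∈ vanishIdeal (degreeLT (Fin k) m) := by
    intro m d i
    induction d with
    | zero => simp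
    | succ d ih =>
      have := add_mem (vanishIdeal_degreeLT_antitone (Nat.le_add_right m d) (hstep (m + d) i)) ih
      rwa [sub_add_sub_cancel] at this
  let q : Fin k → MvPowerSeries (Fin k) ℂ := fun i m => MvPowerSeries.coeff m (p (m.degree + 1) i)
  have hcoeff : ∀ i n m, n.degree < m →
      MvPowerSeries.coeff n (q i) = MvPowerSeries.coeff n (p m i) := by
    intro i n m hnm
    obtain ⟨d, rfl⟩ := Nat.exists_eq_add_of_le (Nat.succ_le_of_lt hnm)
    have := hstable (n.degree + 1) d i n (Nat.lt_succ_self _)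
    rw [map_sub, sub_eq_zero] at this
    exact this.symm
  have hq : ∀ m i, q i - p m i ∈ vanishIdeal (degreeLT (Fin k) m) := by
    intro m i n hn
    rw [map_sub, hcoeff i n m hn, sub_self]
  have hq0 : ∀ i, MvPowerSeries.constantCoeff (q i) = 0 := fun i =>
    (hcoeff i 0 1 (by simp)).trans (hp0 1 i)
  refine ⟨q, fun i => ?_, hq0, funext fun i => ?_⟩
  -- With `‖e i‖_s ≤ 1/2` and radius `s/2`, the ball of norm `s` is preserved by the iteration,
  -- since `s/2 + s/2 = s`.
  · have hev : ∀ᶠ s : ℝ≥0 in 𝓝[>] 0, ∀ i, wnorm s (e i) ≤ (2⁻¹ : ℝ≥0) :=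
      eventually_all.2 fun i => (he i).eventually_wnorm_le (he0 i) (by positivity)
    obtain ⟨s, hs, hs0⟩ := (hev.and self_mem_nhdsWithin).exists
    have hs0' : 0 < s := hs0
    have hb : ∀ m i, wnorm (s * 2⁻¹ : ℝ≥0) (p m i) ≤ s := by
      intro m
      induction m with
      | zero => simp [p, wnorm]
      | succ m ih =>
        rw [hsucc]
        refine wnorm_inverseStep_le (hp0 m) (fun i => (hs i).trans ?_) ?_ ih
        · rw [ENNReal.coe_inv two_ne_zero]; rfl
        · rw [ENNReal.coe_mul, ENNReal.coe_inv two_ne_zero]; rfl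
    refine isConvergent_iff_wnorm.2 ⟨s * 2⁻¹, by positivity,
      ne_top_of_le_ne_top (ENNReal.coe_ne_top (r := s)) ?_⟩
    -- Any finite partial sum of the limit is a partial sum of a late enough iterate, so the uniform
    -- bound passes to the limit.
    rw [wnorm, ENNReal.tsum_eq_iSup_sum]
    refine iSup_le fun F => ?_
    refine le_trans (le_of_eq (Finset.sum_congr rfl fun n hn => ?_))
      ((ENNReal.sum_le_tsum F).trans (hb (F.sup Finsupp.degree + 1) i))
    rw [hcoeff i n _ (Nat.lt_succ_of_le (Finset.le_sup (f := Finsupp.degree) hn))]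
  · ext n
    have h1 := inverseStep_congr he0 hq0 (hp0 n.degree) (hq n.degree) i n (Nat.lt_succ_self _)
    rw [map_sub, sub_eq_zero, ← hsucc] at h1
    rw [h1, hcoeff i n _ (Nat.lt_succ_self _)]

/-- The fixed point equation reads `q i (1 + e i(q)) = X i`. It shows that `q` again has the form `X
i (1 + e' i)`, so that the construction can be repeated on `q`. -/
theorem exists_convergent_right_inverse {k : ℕ} {φ e : Fin k → MvPowerSeries (Fin k) ℂ}
    (he : ∀ i, IsConvergent (e i)) (he0 : ∀ i, MvPowerSeries.constantCoeff (e i) = 0)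
    (hφ : ∀ i, φ i = MvPowerSeries.X i * (1 + e i)) :
    ∃ q e' : Fin k → MvPowerSeries (Fin k) ℂ, (∀ i, IsConvergent (e' i)) ∧
      (∀ i, MvPowerSeries.constantCoeff (e' i) = 0) ∧
      (∀ i, q i = MvPowerSeries.X i * (1 + e' i)) ∧
      (∀ i, IsConvergent (q i) ∧ MvPowerSeries.constantCoeff (q i) = 0) ∧
      ∀ i, MvPowerSeries.subst q (φ i) = MvPowerSeries.X i := by
  obtain ⟨q, hq, hq0, hfix⟩ := exists_convergent_fixedPoint_inverseStep he he0
  have hs := MvPowerSeries.hasSubst_of_constantCoeff_zero hq0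
  have hmul : ∀ i, q i * (1 + MvPowerSeries.subst q (e i)) = MvPowerSeries.X i := by
    intro i
    have := congrFun hfix i
    rw [inverseStep, sub_eq_iff_eq_add] at this
    rw [this]
    ring
  have hunit : ∀ i, MvPowerSeries.constantCoeff (1 + MvPowerSeries.subst q (e i)) = 1 := by
    intro i
    rw [map_add, MvPowerSeries.constantCoeff_subst_eq_zero hs hq0 (he0 i), map_one, add_zero]
  let v : Fin k → MvPowerSeries (Fin k) ℂ := fun i => (1 + MvPowerSeries.subst q (e i))⁻¹
  have hv : ∀ i, (1 + MvPowerSeries.subst q (e i)) * v i = 1 := fun i =>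
    MvPowerSeries.mul_inv_cancel _ (by rw [hunit]; exact one_ne_zero)
  have hqv : ∀ i, q i = MvPowerSeries.X i * v i := fun i => by
    rw [← hmul i, mul_assoc, hv, mul_one]
  refine ⟨q, fun i => v i - 1, fun i => ?_, fun i => ?_, fun i => ?_, fun i => ⟨hq i, hq0 i⟩,
    fun i => ?_⟩
  · have h1 : IsConvergent (v i) := by
      have h2 := hq i
      rw [hqv i] at h2
      exact IsConvergent.of_monomial_mul _ h2
    exact h1.sub isConvergent_one
  · simp [v, MvPowerSeries.constantCoeff_inv, hunit i, -map_add]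
  · rw [add_sub_cancel, hqv]
  · rw [hφ i, MvPowerSeries.subst_mul hs, MvPowerSeries.subst_X hs, MvPowerSeries.subst_add hs,
      ← MvPowerSeries.substAlgHom_apply hs 1, map_one, hmul]

theorem subst_subst_eq_self {k : ℕ} {p q : Fin k → MvPowerSeries (Fin k) ℂ}
    (hp : MvPowerSeries.HasSubst p) (hq : MvPowerSeries.HasSubst q)
    (h : ∀ i, MvPowerSeries.subst q (p i) = MvPowerSeries.X i) (f : MvPowerSeries (Fin k) ℂ) :
    MvPowerSeries.subst q (MvPowerSeries.subst p f) = f := by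
  rw [MvPowerSeries.subst_comp_subst_apply hp hq]
  simp_rw [h]
  exact congrFun MvPowerSeries.subst_self f

theorem exists_convergent_inverse {k : ℕ} {φ e : Fin k → MvPowerSeries (Fin k) ℂ}
    (he : ∀ i, IsConvergent (e i)) (he0 : ∀ i, MvPowerSeries.constantCoeff (e i) = 0)
    (hφ : ∀ i, φ i = MvPowerSeries.X i * (1 + e i)) :
    ∃ q : Fin k → MvPowerSeries (Fin k) ℂ,
      (∀ i, IsConvergent (q i) ∧ MvPowerSeries.constantCoeff (q i) = 0) ∧
      (∀ i, MvPowerSeries.subst q (φ i) = MvPowerSeries.X i) ∧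
      ∀ i, MvPowerSeries.subst φ (q i) = MvPowerSeries.X i := by
  obtain ⟨q, e', he', he0', hq, hqc, hqφ⟩ := exists_convergent_right_inverse he he0 hφ
  -- As in a monoid, an element with a right inverse that itself has a right inverse is invertible.
  obtain ⟨q', -, -, -, -, hqc', hqq'⟩ := exists_convergent_right_inverse he' he0' hq
  have hφ0 : ∀ i, MvPowerSeries.constantCoeff (φ i) = 0 := fun i => by simp [hφ]
  have sφ := MvPowerSeries.hasSubst_of_constantCoeff_zero hφ0
  have sq := MvPowerSeries.hasSubst_of_constantCoeff_zero fun i => (hqc i).2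
  have sq' := MvPowerSeries.hasSubst_of_constantCoeff_zero fun i => (hqc' i).2
  refine ⟨q, hqc, hqφ, fun i => ?_⟩
  have h1 := subst_subst_eq_self sφ sq hqφ (q i)
  have h2 := congrArg (MvPowerSeries.subst q') h1
  rw [subst_subst_eq_self sq sq' hqq', hqq'] at h2
  exact h2

theorem isGermIso_of_eq_X_mul {k : ℕ} {φ e : Fin k → MvPowerSeries (Fin k) ℂ}
    (he : ∀ i, IsConvergent (e i)) (he0 : ∀ i, MvPowerSeries.constantCoeff (e i) = 0)
    (hφ : ∀ i, φ i = MvPowerSeries.X i * (1 + e i)) : IsGermIso φ := by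
  refine ⟨fun i => ⟨?_, by simp [hφ]⟩, exists_convergent_inverse he he0 hφ⟩
  rw [hφ]
  exact (isConvergent_X i).mul (isConvergent_one.add (he i))

/-! ### Series of the form monomial times unit -/

/-- `q = t^α u` with `u(0) ≠ 0`. -/
def IsMonomialUnit {r : ℕ} (α : Fin r →₀ ℕ) (q : MvPowerSeries (Fin r) ℂ) : Prop :=
  ∃ u, MvPowerSeries.constantCoeff u ≠ 0 ∧ q = MvPowerSeries.monomial α (1 : ℂ) * u

theorem isMonomialUnit_iff {r : ℕ} {α : Fin r →₀ ℕ} {q : MvPowerSeries (Fin r) ℂ} :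
    IsMonomialUnit α q ↔
      MvPowerSeries.coeff α q ≠ 0 ∧ ∀ m, MvPowerSeries.coeff m q ≠ 0 → α ≤ m := by
  constructor
  · rintro ⟨u, hu, rfl⟩
    refine ⟨?_, fun m hm => ?_⟩
    · rw [MvPowerSeries.coeff_monomial_mul, if_pos le_rfl, one_mul, tsub_self]
      exact hu
    · by_contra h
      rw [MvPowerSeries.coeff_monomial_mul, if_neg h] at hm
      exact hm rfl
  · rintro ⟨h0, h⟩
    let u : MvPowerSeries (Fin r) ℂ := fun m => MvPowerSeries.coeff (α + m) q
    have hu : ∀ m, MvPowerSeries.coeff m u = MvPowerSeries.coeff (α + m) q := fun m => rfl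
    refine ⟨u, ?_, ?_⟩
    · rwa [← MvPowerSeries.coeff_zero_eq_constantCoeff_apply, hu, add_zero]
    ext m
    rw [MvPowerSeries.coeff_monomial_mul]
    split_ifs with hm
    · rw [one_mul, hu, add_tsub_cancel_of_le hm]
    · by_contra h'
      exact hm (h m h')

namespace IsMonomialUnit

variable {r : ℕ} {α β : Fin r →₀ ℕ} {p q : MvPowerSeries (Fin r) ℂ}

theorem ne_zero (h : IsMonomialUnit α q) : q ≠ 0 := by
  rintro rfl
  exact (isMonomialUnit_iff.1 h).1 (map_zero _)

theorem unique (h : IsMonomialUnit α q) (h' : IsMonomialUnit β q) : α = β := by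
  rw [isMonomialUnit_iff] at h h'
  exact le_antisymm (h.2 _ h'.1) (h'.2 _ h.1)

theorem mul (h : IsMonomialUnit α p) (h' : IsMonomialUnit β q) :
    IsMonomialUnit (α + β) (p * q) := by
  obtain ⟨u, hu, rfl⟩ := h
  obtain ⟨v, hv, rfl⟩ := h'
  refine ⟨u * v, by rw [map_mul]; exact mul_ne_zero hu hv, ?_⟩
  rw [mul_mul_mul_comm, MvPowerSeries.monomial_mul_monomial, one_mul]

theorem mul_unit (h : IsMonomialUnit α p) (hq : MvPowerSeries.constantCoeff q ≠ 0) :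
    IsMonomialUnit α (p * q) := by
  obtain ⟨u, hu, rfl⟩ := h
  exact ⟨u * q, by rw [map_mul]; exact mul_ne_zero hu hq, mul_assoc _ _ _⟩

/-- For each variable, the smallest exponent occurring in a series is additive under products, being
a weighted order over a domain. The coordinatewise minima `μ`, `ν` of the factors thus add up to
`γ`. -/
theorem of_mul_left {γ : Fin r →₀ ℕ} (h : IsMonomialUnit γ (p * q)) :
    ∃ α, IsMonomialUnit α p := by
  classical
  have hpq := h.ne_zero
  have hp : p ≠ 0 := left_ne_zero_of_mul hpq
  have hq : q ≠ 0 := right_ne_zero_of_mul hpq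
  obtain ⟨h0, h1⟩ := isMonomialUnit_iff.1 h
  let w : Fin r → Fin r → ℕ := fun i => Pi.single i 1
  have hw : ∀ i (m : Fin r →₀ ℕ), Finsupp.weight (w i) m = m i := by
    intro i m
    simp [Finsupp.weight_apply, Finsupp.sum_fintype, w, Pi.single_apply]
  have hord : ∀ f : MvPowerSeries (Fin r) ℂ, f ≠ 0 → ∃ μ : Fin r →₀ ℕ,
      (∀ i, f.weightedOrder (w i) = μ i) ∧ ∀ m, MvPowerSeries.coeff m f ≠ 0 → μ ≤ m := by
    intro f hf
    refine ⟨Finsupp.equivFunOnFinite.symm fun i => (f.weightedOrder (w i)).toNat, fun i => ?_,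
      fun m hm i => ?_⟩
    · exact ((MvPowerSeries.ne_zero_iff_weightedOrder_finite (w i)).1 hf).symm
    · have := MvPowerSeries.weightedOrder_le (w i) hm
      rw [hw, ← (MvPowerSeries.ne_zero_iff_weightedOrder_finite (w i)).1 hf] at this
      exact_mod_cast this
  obtain ⟨μ, hμ, hμ'⟩ := hord p hp
  obtain ⟨ν, hν, hν'⟩ := hord q hq
  obtain ⟨κ, hκ, hκ'⟩ := hord (p * q) hpq
  have hsum : κ = μ + ν := by
    ext i
    have := MvPowerSeries.weightedOrder_mul (w i) p q
    rw [hμ, hν, hκ] at this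
    exact_mod_cast this
  have hγ : γ = μ + ν := by
    rw [← hsum]
    refine le_antisymm (fun i => ?_) (hκ' _ h0)
    have h2 : (γ i : ℕ∞) ≤ (p * q).weightedOrder (w i) := by
      refine MvPowerSeries.nat_le_weightedOrder (w i) fun d hd => ?_
      rw [hw] at hd
      by_contra h3
      exact absurd (h1 d h3 i) (not_le.2 hd)
    rw [hκ] at h2
    exact_mod_cast h2
  -- The only pair of exponents of `p` and `q` with sum `μ + ν` is `(μ, ν)`, so `p` has a term at
  -- `μ`.
  refine ⟨μ, isMonomialUnit_iff.2 ⟨fun hμ0 => h0 ?_, hμ'⟩⟩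
  rw [MvPowerSeries.coeff_mul]
  refine Finset.sum_eq_zero fun x hx => ?_
  have hx' : x.1 + x.2 = γ := Finset.HasAntidiagonal.mem_antidiagonal.1 hx
  by_contra hne
  have hx1 := hμ' _ (left_ne_zero_of_mul hne)
  have hx2 := hν' _ (right_ne_zero_of_mul hne)
  have : x.1 = μ := by
    ext i
    have e1 := DFunLike.congr_fun (hx'.trans hγ) i
    have e2 := hx1 i
    have e3 := hx2 i
    simp only [Finsupp.add_apply] at e1
    omega
  rw [this] at hne
  exact left_ne_zero_of_mul hne hμ0

theorem of_dvd {γ : Fin r →₀ ℕ} (h : IsMonomialUnit γ q) (hd : p ∣ q) :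
    ∃ α, IsMonomialUnit α p := by
  obtain ⟨c, rfl⟩ := hd
  exact h.of_mul_left

theorem prod {ι : Type*} {s : Finset ι} {f : ι → MvPowerSeries (Fin r) ℂ}
    (h : ∀ i ∈ s, ∃ α, IsMonomialUnit α (f i)) : ∃ α, IsMonomialUnit α (∏ i ∈ s, f i) := by
  classical
  induction s using Finset.induction_on with
  | empty => exact ⟨0, 1, by simp, by simp⟩
  | insert i s hi ih =>
    rw [Finset.prod_insert hi]
    obtain ⟨a, ha⟩ := h i (Finset.mem_insert_self _ _)
    obtain ⟨b, hb⟩ := ih fun j hj => h j (Finset.mem_insert_of_mem hj)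
    exact ⟨_, ha.mul hb⟩

theorem neg (h : IsMonomialUnit α q) : IsMonomialUnit α (-q) := by
  rw [isMonomialUnit_iff] at h ⊢
  simpa using h

theorem subst {ψ e : Fin r → MvPowerSeries (Fin r) ℂ}
    (hψ : ∀ i, ψ i = MvPowerSeries.X i * e i)
    (he : ∀ i, MvPowerSeries.constantCoeff (e i) ≠ 0) (h : IsMonomialUnit α q) :
    IsMonomialUnit α (MvPowerSeries.subst ψ q) := by
  obtain ⟨u, hu, rfl⟩ := h
  have hψ0 : ∀ i, MvPowerSeries.constantCoeff (ψ i) = 0 := fun i => by simp [hψ]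
  have hs := MvPowerSeries.hasSubst_of_constantCoeff_zero hψ0
  refine ⟨(α.prod fun i k => e i ^ k) * MvPowerSeries.subst ψ u, ?_, ?_⟩
  · rw [map_mul, map_finsuppProd]
    refine mul_ne_zero (Finset.prod_ne_zero_iff.2 fun i _ => ?_) ?_
    · dsimp only
      rw [map_pow]
      exact pow_ne_zero _ (he i)
    · have h1 : u = (u - MvPowerSeries.C (MvPowerSeries.constantCoeff u)) +
          MvPowerSeries.C (MvPowerSeries.constantCoeff u) := (sub_add_cancel _ _).symm
      rw [h1, MvPowerSeries.subst_add hs, map_add, MvPowerSeries.subst_C,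
        MvPowerSeries.constantCoeff_subst_eq_zero hs hψ0 (by simp)]
      simpa using hu
  · rw [MvPowerSeries.subst_mul hs, MvPowerSeries.subst_monomial hs, map_one, one_mul, ← mul_assoc,
      MvPowerSeries.monomial_one_eq, ← Finsupp.prod_mul]
    simp_rw [hψ, mul_pow]

end IsMonomialUnit

/-! ### Dominant exponents in two variables -/

/-- The set `L` of points lexicographically not below `μ` is convex and contains the polyhedron. A
segment in `L` through `μ` in its interior is constant, first in coordinate `i`, then in `j`. -/
theorem extremePoint_of_lex_minimal {q : MvPowerSeries (Fin 2) ℂ} {i j : Fin 2}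
    (hij : ∀ l, l = i ∨ l = j) {μ : Fin 2 →₀ ℕ} (hμ : MvPowerSeries.coeff μ q ≠ 0)
    (h1 : ∀ m, MvPowerSeries.coeff m q ≠ 0 → μ i ≤ m i)
    (h2 : ∀ m, MvPowerSeries.coeff m q ≠ 0 → m i = μ i → μ j ≤ m j) :
    (fun l => (μ l : ℝ)) ∈ (newtonPolyhedron q).extremePoints ℝ := by
  let L : Set (Fin 2 → ℝ) := {x | (μ i : ℝ) ≤ x i ∧ (x i = μ i → (μ j : ℝ) ≤ x j)}
  have hL : Convex ℝ L := by
    rw [convex_iff_forall_pos]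
    rintro x ⟨hx1, hx2⟩ y ⟨hy1, hy2⟩ a b ha hb hab
    have hb' : b = 1 - a := by linarith
    refine ⟨?_, fun h => ?_⟩
    · simp only [Pi.add_apply, Pi.smul_apply, smul_eq_mul]
      nlinarith
    · simp only [Pi.add_apply, Pi.smul_apply, smul_eq_mul] at h ⊢
      have ex : x i = μ i := by
        refine le_antisymm ?_ hx1
        have := mul_le_mul_of_nonneg_left hy1 hb.le
        have : a * x i ≤ a * μ i := by rw [hb'] at *; linarith
        exact le_of_mul_le_mul_left this ha
      have ey : y i = μ i := by
        refine le_antisymm ?_ hy1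
        have : b * y i ≤ b * μ i := by rw [ex] at h; rw [hb'] at *; linarith
        exact le_of_mul_le_mul_left this hb
      have e1 := mul_le_mul_of_nonneg_left (hx2 ex) ha.le
      have e2 := mul_le_mul_of_nonneg_left (hy2 ey) hb.le
      rw [hb'] at e2 ⊢
      linarith
  have hsub : newtonPolyhedron q ⊆ L := by
    refine convexHull_min ?_ hL
    rintro x ⟨m, hm, hmx⟩
    refine ⟨le_trans (by exact_mod_cast h1 m hm) (hmx i), fun hx => ?_⟩
    have h3 : m i = μ i := by
      refine le_antisymm ?_ (h1 m hm)
      have := hmx i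
      rw [hx] at this
      exact_mod_cast this
    exact le_trans (by exact_mod_cast h2 m hm h3) (hmx j)
  rw [mem_extremePoints_iff_left]
  refine ⟨subset_convexHull ℝ _ ⟨μ, hμ, fun _ => le_rfl⟩, ?_⟩
  rintro x hx y hy ⟨a, b, ha, hb, hab, hz⟩
  obtain ⟨hx1, hx2⟩ := hsub hx
  obtain ⟨hy1, hy2⟩ := hsub hy
  have hb' : b = 1 - a := by linarith
  have hzi := congrFun hz i
  have hzj := congrFun hz j
  simp only [Pi.add_apply, Pi.smul_apply, smul_eq_mul] at hzi hzj
  have key : ∀ c s t : ℝ, c ≤ s → c ≤ t → a * s + b * t = c → s = c ∧ t = c := by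
    intro c s t hs ht h
    have e1 := mul_le_mul_of_nonneg_left hs ha.le
    have e2 := mul_le_mul_of_nonneg_left ht hb.le
    have e3 : a * c + b * c = c := by rw [← add_mul, hab, one_mul]
    exact ⟨le_antisymm (le_of_mul_le_mul_left (by linarith) ha) hs,
      le_antisymm (le_of_mul_le_mul_left (by linarith) hb) ht⟩
  obtain ⟨ei, fi⟩ := key _ _ _ hx1 hy1 hzi
  obtain ⟨ej, -⟩ := key _ _ _ (hx2 ei) (hy2 fi) hzj
  funext l
  rcases hij l with rfl | rfl
  · exact ei
  · exact ej

/-- The lexicographic minima of the support, for both orders of the coordinates, are vertices, hence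
equal `γ`. So `γ` is minimal in each coordinate. As an extreme point it lies in the generating set,
hence above some exponent of `q`, which must be `γ` itself. -/
theorem HasDominantExponent.isMonomialUnit {q : MvPowerSeries (Fin 2) ℂ} {γ : Fin 2 →₀ ℕ}
    (h : HasDominantExponent q γ) : IsMonomialUnit γ q := by
  classical
  have key : ∀ i j : Fin 2, (∀ l, l = i ∨ l = j) → ∀ m, MvPowerSeries.coeff m q ≠ 0 →
      γ i ≤ m i := by
    intro i j hij m hm
    have ex1 : ∃ c, ∃ m : Fin 2 →₀ ℕ, MvPowerSeries.coeff m q ≠ 0 ∧ m i = c := ⟨_, m, hm, rfl⟩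
    obtain ⟨m₁, hm₁, hc₁⟩ := Nat.find_spec ex1
    have ex2 : ∃ d, ∃ m : Fin 2 →₀ ℕ, MvPowerSeries.coeff m q ≠ 0 ∧ m i = Nat.find ex1 ∧ m j = d :=
      ⟨_, m₁, hm₁, hc₁, rfl⟩
    obtain ⟨μ, hμ, hμi, hμj⟩ := Nat.find_spec ex2
    have hmin : ∀ m, MvPowerSeries.coeff m q ≠ 0 → μ i ≤ m i := fun m hm =>
      hμi ▸ Nat.find_min' ex1 ⟨m, hm, rfl⟩
    have hext := extremePoint_of_lex_minimal hij hμ hmin fun m hm hmi =>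
      hμj ▸ Nat.find_min' ex2 ⟨m, hm, hmi.trans hμi, rfl⟩
    rw [h, Set.mem_singleton_iff] at hext
    have : μ i = γ i := by exact_mod_cast congrFun hext i
    exact this ▸ hmin m hm
  have hle : ∀ m, MvPowerSeries.coeff m q ≠ 0 → γ ≤ m := by
    intro m hm i
    fin_cases i
    · exact key 0 1 (by decide) m hm
    · exact key 1 0 (by decide) m hm
  refine isMonomialUnit_iff.2 ⟨?_, hle⟩
  have hγ : (fun i => (γ i : ℝ)) ∈ (newtonPolyhedron q).extremePoints ℝ := by
    rw [h]
    exact Set.mem_singleton _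
  obtain ⟨m, hm, hmγ⟩ := extremePoints_convexHull_subset hγ
  have : m = γ := le_antisymm (fun i => Nat.cast_le.1 (hmγ i)) (hle m hm)
  exact this ▸ hm

/-! ### Conjugates -/

/-- The conjugate `S(ω₁ t₁, …, ω_r t_r)` of `S`, for `n`-th roots of unity `ωᵢ`. -/
noncomputable def conj {n r : ℕ} (ω : Fin r → rootsOfUnity n ℂ) :
    MvPowerSeries (Fin r) ℂ →+* MvPowerSeries (Fin r) ℂ :=
  MvPowerSeries.rescale fun i => ((ω i : ℂˣ) : ℂ)

section conj

variable {n r : ℕ} (ω ω' : Fin r → rootsOfUnity n ℂ) (S : MvPowerSeries (Fin r) ℂ)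

theorem coeff_conj (m : Fin r →₀ ℕ) : MvPowerSeries.coeff m (conj ω S) =
    (m.prod fun i k => ((ω i : ℂˣ) : ℂ) ^ k) * MvPowerSeries.coeff m S :=
  MvPowerSeries.coeff_rescale _ _ _

theorem conj_conj : conj ω (conj ω' S) = conj (ω' * ω) S :=
  MvPowerSeries.rescale_rescale _ _ _

theorem conj_one : conj (1 : Fin r → rootsOfUnity n ℂ) S = S := by
  ext m
  simp [coeff_conj, Finsupp.prod]

theorem conj_inv_conj : conj ω⁻¹ (conj ω S) = S := by
  rw [conj_conj, mul_inv_cancel, conj_one]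

theorem prod_rootsOfUnity_pow_ne_zero (m : Fin r →₀ ℕ) :
    (m.prod fun i k => ((ω i : ℂˣ) : ℂ) ^ k) ≠ 0 :=
  Finset.prod_ne_zero_iff.2 fun _ _ => pow_ne_zero _ (Units.ne_zero _)

theorem coeff_conj_ne_zero_iff (m : Fin r →₀ ℕ) :
    MvPowerSeries.coeff m (conj ω S) ≠ 0 ↔ MvPowerSeries.coeff m S ≠ 0 := by
  rw [coeff_conj, mul_ne_zero_iff, and_iff_right (prod_rootsOfUnity_pow_ne_zero ω m)]

theorem constantCoeff_conj :
    MvPowerSeries.constantCoeff (conj ω S) = MvPowerSeries.constantCoeff S := by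
  simp only [← MvPowerSeries.coeff_zero_eq_constantCoeff_apply, coeff_conj, Finsupp.prod_zero_index,
    one_mul]

variable {S} in
theorem isMonomialUnit_conj {α : Fin r →₀ ℕ} :
    IsMonomialUnit α (conj ω S) ↔ IsMonomialUnit α S := by
  simp_rw [isMonomialUnit_iff, coeff_conj_ne_zero_iff]

theorem norm_rootsOfUnity [NeZero n] (ζ : rootsOfUnity n ℂ) : ‖((ζ : ℂˣ) : ℂ)‖ = 1 :=
  Complex.norm_eq_one_of_mem_rootsOfUnity ζ.2

variable {S} in
theorem IsConvergent.conj [NeZero n] (hS : IsConvergent S) : IsConvergent (conj ω S) := by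
  obtain ⟨R, hR, h⟩ := hS
  refine ⟨R, hR, h.congr fun m => ?_⟩
  rw [coeff_conj, norm_mul, Finsupp.prod, norm_prod]
  simp_rw [norm_pow, norm_rootsOfUnity, one_pow, Finset.prod_const_one, one_mul]

end conj

/-! ### The inclusion `ℂ{X} → ℂ{t}`, `Xᵢ = tᵢⁿ` -/

/-- The ring homomorphism `g(X) ↦ g(t₁ⁿ, …, t_rⁿ)`. -/
noncomputable def powHom (n r : ℕ) [NeZero n] : ConvSeries r →+* MvPowerSeries (Fin r) ℂ :=
  (MvPowerSeries.expand n (NeZero.ne n)).toRingHom.comp (ConvSeries r).val.toRingHom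

section powHom

variable {n r : ℕ} [NeZero n]

theorem powHom_apply (g : ConvSeries r) :
    powHom n r g = MvPowerSeries.expand n (NeZero.ne n) (g : MvPowerSeries (Fin r) ℂ) := rfl

theorem powHom_eq_subst (g : ConvSeries r) : powHom n r g =
    MvPowerSeries.subst (fun i : Fin r => (MvPowerSeries.X i : MvPowerSeries (Fin r) ℂ) ^ n)
      (g : MvPowerSeries (Fin r) ℂ) := by
  rw [powHom_apply, MvPowerSeries.expand, MvPowerSeries.substAlgHom_apply]

theorem coeff_smul_powHom (g : ConvSeries r) (m : Fin r →₀ ℕ) :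
    MvPowerSeries.coeff (n • m) (powHom n r g) =
      MvPowerSeries.coeff m (g : MvPowerSeries (Fin r) ℂ) :=
  MvPowerSeries.coeff_expand_smul _ (NeZero.ne n) _ _

theorem exists_smul_eq_of_forall_dvd {n r : ℕ} {m : Fin r →₀ ℕ} (h : ∀ i, n ∣ m i) :
    ∃ d : Fin r →₀ ℕ, m = n • d := by
  choose d hd using h
  exact ⟨Finsupp.equivFunOnFinite.symm d, by ext i; simp [hd i]⟩

theorem exists_smul_eq_of_coeff_powHom_ne_zero {g : ConvSeries r} {m : Fin r →₀ ℕ}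
    (h : MvPowerSeries.coeff m (powHom n r g) ≠ 0) : ∃ d : Fin r →₀ ℕ, m = n • d := by
  refine exists_smul_eq_of_forall_dvd fun i => ?_
  by_contra hi
  exact h (MvPowerSeries.coeff_expand_of_not_dvd n (NeZero.ne n) _ hi)

theorem smul_le_smul_iff_exponent {α β : Fin r →₀ ℕ} : n • α ≤ n • β ↔ α ≤ β := by
  simp only [Finsupp.le_def, Finsupp.smul_apply, smul_eq_mul,
    Nat.mul_le_mul_left_iff (NeZero.pos n)]

theorem powHom_injective : Function.Injective (powHom n r) := by
  intro f g h
  ext m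
  rw [← coeff_smul_powHom (n := n), h, coeff_smul_powHom]

theorem constantCoeff_powHom (g : ConvSeries r) : MvPowerSeries.constantCoeff (powHom n r g) =
    MvPowerSeries.constantCoeff (g : MvPowerSeries (Fin r) ℂ) :=
  MvPowerSeries.constantCoeff_expand _ (NeZero.ne n) _

theorem conj_powHom (ω : Fin r → rootsOfUnity n ℂ) (g : ConvSeries r) :
    conj ω (powHom n r g) = powHom n r g := by
  ext m
  rw [coeff_conj]
  by_cases h : MvPowerSeries.coeff m (powHom n r g) = 0
  · rw [h, mul_zero]
  · obtain ⟨d, rfl⟩ := exists_smul_eq_of_coeff_powHom_ne_zero h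
    have h1 : ((n • d).prod fun i k => ((ω i : ℂˣ) : ℂ) ^ k) = 1 := by
      rw [Finsupp.prod_fintype _ _ fun i => pow_zero _]
      refine Finset.prod_eq_one fun i _ => ?_
      rw [Finsupp.smul_apply, smul_eq_mul, pow_mul, ← Units.val_pow_eq_pow_val,
        (mem_rootsOfUnity n _).1 (ω i).2, Units.val_one, one_pow]
    rw [h1, one_mul]

/-- Twisting one variable at a time by a primitive `n`-th root of unity forces all exponents to be
divisible by `n`. -/
theorem exists_powHom_eq_of_forall_conj_eq {S : MvPowerSeries (Fin r) ℂ} (hS : IsConvergent S)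
    (h : ∀ ω : Fin r → rootsOfUnity n ℂ, conj ω S = S) : ∃ g, powHom n r g = S := by
  classical
  have hdvd : ∀ m, MvPowerSeries.coeff m S ≠ 0 → ∃ d : Fin r →₀ ℕ, m = n • d := by
    intro m hm
    refine exists_smul_eq_of_forall_dvd fun i => ?_
    have hζ := Complex.isPrimitiveRoot_exp n (NeZero.ne n)
    let ζ : rootsOfUnity n ℂ := rootsOfUnity.mkOfPowEq _ hζ.pow_eq_one
    have h1 := congrArg (MvPowerSeries.coeff m) (h (Function.update 1 i ζ))
    rw [coeff_conj, Finsupp.prod_fintype _ _ fun i => pow_zero _, mul_eq_right₀ hm,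
      Fintype.prod_eq_single i] at h1
    · rw [Function.update_self, rootsOfUnity.coe_mkOfPowEq] at h1
      exact hζ.dvd_of_pow_eq_one _ h1
    · intro j hj
      simp [Function.update_of_ne hj]
  let g : MvPowerSeries (Fin r) ℂ := fun m => MvPowerSeries.coeff (n • m) S
  have hgc : ∀ m, MvPowerSeries.coeff m g = MvPowerSeries.coeff (n • m) S := fun m => rfl
  have hg : IsConvergent g := by
    obtain ⟨R, hR, h⟩ := hS
    have hinj : Function.Injective fun m : Fin r →₀ ℕ => n • m := nsmul_right_injective (NeZero.ne n)
    refine ⟨R ^ n, by positivity, (h.comp_injective hinj).congr fun m => ?_⟩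
    rw [Function.comp_apply, hgc, map_nsmul, smul_eq_mul, pow_mul]
  refine ⟨⟨g, hg⟩, ?_⟩
  ext m
  by_cases hm : ∃ d : Fin r →₀ ℕ, m = n • d
  · obtain ⟨d, rfl⟩ := hm
    rw [coeff_smul_powHom]
    exact hgc d
  · rw [not_imp_comm.1 (hdvd m) hm, not_imp_comm.1 exists_smul_eq_of_coeff_powHom_ne_zero hm]

theorem isMonomialUnit_smul_powHom_iff {g : ConvSeries r} {α : Fin r →₀ ℕ} :
    IsMonomialUnit (n • α) (powHom n r g) ↔ IsMonomialUnit α (g : MvPowerSeries (Fin r) ℂ) := by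
  rw [isMonomialUnit_iff, isMonomialUnit_iff, coeff_smul_powHom]
  refine and_congr_right fun _ => ⟨fun h m hm => ?_, fun h m hm => ?_⟩
  · rw [← smul_le_smul_iff_exponent (n := n)]
    exact h _ (by rwa [coeff_smul_powHom])
  · obtain ⟨d, rfl⟩ := exists_smul_eq_of_coeff_powHom_ne_zero hm
    rw [smul_le_smul_iff_exponent]
    exact h _ (by rwa [coeff_smul_powHom] at hm)

theorem exists_isMonomialUnit_powHom_iff {g : ConvSeries r} :
    (∃ α, IsMonomialUnit α (powHom n r g)) ↔
      ∃ (α : Fin r →₀ ℕ) (u : MvPowerSeries (Fin r) ℂ), IsConvergent u ∧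
        MvPowerSeries.constantCoeff u ≠ 0 ∧
        (g : MvPowerSeries (Fin r) ℂ) = MvPowerSeries.monomial α (1 : ℂ) * u := by
  constructor
  · rintro ⟨α, h⟩
    obtain ⟨β, rfl⟩ := exists_smul_eq_of_coeff_powHom_ne_zero (isMonomialUnit_iff.1 h).1
    obtain ⟨u, hu, hgu⟩ := isMonomialUnit_smul_powHom_iff.1 h
    have hg : IsConvergent (g : MvPowerSeries (Fin r) ℂ) := g.2
    rw [hgu] at hg
    exact ⟨β, u, hg.of_monomial_mul, hu, hgu⟩
  · rintro ⟨α, u, -, hu, hgu⟩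
    exact ⟨_, isMonomialUnit_smul_powHom_iff.2 ⟨u, hu, hgu⟩⟩

theorem isBranch_iff {f : (ConvSeries r)[X]} {S : MvPowerSeries (Fin r) ℂ} :
    IsBranch n f S ↔ IsConvergent S ∧ (f.map (powHom n r)).IsRoot S := by
  rw [IsBranch, Polynomial.IsRoot.def, Polynomial.eval_map, Polynomial.eval₂_eq_sum_range]
  simp_rw [powHom_eq_subst]

end powHom

/-! ### The minimal polynomial of a branch -/

/-- The set of conjugates of `S`. -/
noncomputable def orbit (n : ℕ) {r : ℕ} [NeZero n] (S : MvPowerSeries (Fin r) ℂ) :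
    Finset (MvPowerSeries (Fin r) ℂ) :=
  (Set.finite_range fun ω : Fin r → rootsOfUnity n ℂ => conj ω S).toFinset

/-- The product of `Y - ξ` over the conjugates `ξ` of `S`. -/
noncomputable def orbitPoly (n : ℕ) {r : ℕ} [NeZero n] (S : MvPowerSeries (Fin r) ℂ) :
    (MvPowerSeries (Fin r) ℂ)[X] :=
  ∏ ξ ∈ orbit n S, (Polynomial.X - Polynomial.C ξ)

section orbit

instance (r : ℕ) : IsDomain (MvPowerSeries (Fin r) ℂ) := NoZeroDivisors.to_isDomain _

variable {n r : ℕ} [NeZero n] {S : MvPowerSeries (Fin r) ℂ}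

theorem mem_orbit {ξ : MvPowerSeries (Fin r) ℂ} :
    ξ ∈ orbit n S ↔ ∃ ω : Fin r → rootsOfUnity n ℂ, conj ω S = ξ := by
  simp [orbit]

theorem self_mem_orbit : S ∈ orbit n S := mem_orbit.2 ⟨1, conj_one S⟩

theorem monic_orbitPoly : (orbitPoly n S).Monic := Polynomial.monic_prod_X_sub_C _ _

theorem natDegree_orbitPoly : (orbitPoly n S).natDegree = (orbit n S).card :=
  Polynomial.natDegree_finsetProd_X_sub_C_eq_card _ _

theorem card_orbit_pos : 0 < (orbit n S).card := Finset.card_pos.2 ⟨S, self_mem_orbit⟩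

theorem isRoot_orbitPoly {ξ : MvPowerSeries (Fin r) ℂ} :
    (orbitPoly n S).IsRoot ξ ↔ ξ ∈ orbit n S := by
  rw [orbitPoly, Polynomial.IsRoot.def, Polynomial.eval_prod, Finset.prod_eq_zero_iff]
  constructor
  · rintro ⟨η, hη, h⟩
    rw [Polynomial.eval_sub, Polynomial.eval_X, Polynomial.eval_C, sub_eq_zero] at h
    exact h ▸ hη
  · exact fun h => ⟨ξ, h, by simp⟩

theorem IsConvergent.of_mem_orbit (hS : IsConvergent S) {ξ : MvPowerSeries (Fin r) ℂ}
    (hξ : ξ ∈ orbit n S) : IsConvergent ξ := by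
  obtain ⟨ω, rfl⟩ := mem_orbit.1 hξ
  exact hS.conj ω

theorem map_conj_orbitPoly (ω : Fin r → rootsOfUnity n ℂ) :
    (orbitPoly n S).map (conj ω) = orbitPoly n S := by
  rw [orbitPoly, Polynomial.map_prod]
  simp_rw [Polynomial.map_sub, Polynomial.map_X, Polynomial.map_C]
  refine Finset.prod_bij (fun ξ _ => conj ω ξ) ?_ ?_ ?_ fun _ _ => rfl
  · intro ξ hξ
    obtain ⟨ω', rfl⟩ := mem_orbit.1 hξ
    exact mem_orbit.2 ⟨_, (conj_conj _ _ _).symm⟩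
  · intro ξ _ η _ h
    rw [← conj_inv_conj ω ξ, h, conj_inv_conj]
  · intro ξ hξ
    obtain ⟨ω', rfl⟩ := mem_orbit.1 hξ
    refine ⟨conj (ω' * ω⁻¹) S, mem_orbit.2 ⟨_, rfl⟩, ?_⟩
    rw [conj_conj, inv_mul_cancel_right]

theorem isConvergent_coeff_orbitPoly (hS : IsConvergent S) (k : ℕ) :
    IsConvergent ((orbitPoly n S).coeff k) := by
  have h : orbitPoly n S ∈ Polynomial.lifts (ConvSeries r).val.toRingHom := by
    refine Subsemiring.prod_mem _ fun ξ hξ => ?_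
    rw [Polynomial.mem_lifts]
    refine ⟨Polynomial.X - Polynomial.C ⟨ξ, hS.of_mem_orbit hξ⟩, ?_⟩
    rw [Polynomial.map_sub, Polynomial.map_X, Polynomial.map_C]
    rfl
  obtain ⟨g, hg⟩ := (Polynomial.lifts_iff_coeff_lifts _).1 h k
  rw [← hg]
  exact g.2

theorem exists_map_powHom_eq_orbitPoly (hS : IsConvergent S) :
    ∃ f : (ConvSeries r)[X], f.map (powHom n r) = orbitPoly n S ∧
      f.natDegree = (orbit n S).card ∧ f.Monic := by
  rw [← natDegree_orbitPoly]
  refine Polynomial.lifts_and_natDegree_eq_and_monic ?_ monic_orbitPoly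
  rw [Polynomial.lifts_iff_coeff_lifts]
  intro k
  refine exists_powHom_eq_of_forall_conj_eq (isConvergent_coeff_orbitPoly hS k) fun ω => ?_
  rw [← Polynomial.coeff_map, map_conj_orbitPoly]

theorem orbitPoly_dvd_map_powHom {f : (ConvSeries r)[X]} (hf : f.Monic)
    (h : (f.map (powHom n r)).IsRoot S) : orbitPoly n S ∣ f.map (powHom n r) := by
  have h0 : f.map (powHom n r) ≠ 0 := (hf.map _).ne_zero
  rw [orbitPoly, Finset.prod, Multiset.prod_X_sub_C_dvd_iff_le_roots h0,
    Multiset.le_iff_subset (orbit n S).nodup]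
  intro ξ hξ
  obtain ⟨ω, rfl⟩ := mem_orbit.1 hξ
  rw [Polynomial.mem_roots h0, Polynomial.IsRoot.def, Polynomial.eval_map]
  rw [Polynomial.IsRoot.def, Polynomial.eval_map] at h
  have h1 := Polynomial.hom_eval₂ f (powHom n r) (conj ω) S
  have h2 : (conj ω).comp (powHom n r) = powHom n r := RingHom.ext (conj_powHom ω)
  rw [h, map_zero, h2] at h1
  exact h1.symm

/-- The orbit polynomial is invariant under conjugation, so it descends to `ℂ{X}`. Divisibility by a
monic polynomial descends along an injection, and irreducibility turns it into equality. -/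
theorem map_powHom_eq_orbitPoly (hS : IsConvergent S) {f : (ConvSeries r)[X]} (hf : f.Monic)
    (hirr : Irreducible f) (h : (f.map (powHom n r)).IsRoot S) :
    f.map (powHom n r) = orbitPoly n S := by
  obtain ⟨g, hg, hdeg, hgm⟩ := exists_map_powHom_eq_orbitPoly (n := n) hS
  have h1 : g ∣ f := by
    rw [← Polynomial.map_dvd_map _ (powHom_injective (n := n)) hgm, hg]
    exact orbitPoly_dvd_map_powHom hf h
  have h2 : ¬ IsUnit g := fun hu => by
    have := card_orbit_pos (n := n) (S := S)
    rw [hgm.eq_one_of_isUnit hu, Polynomial.natDegree_one] at hdeg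
    omega
  rw [← hg, Polynomial.eq_of_monic_of_associated hgm hf
    ((hirr.dvd_iff.1 h1).resolve_left h2).symm]

/-- In a factorization into monic polynomials, the factor vanishing at `S` vanishes at all its
conjugates and so has full degree. -/
theorem irreducible_of_map_powHom_eq_orbitPoly {f : (ConvSeries r)[X]} (hf : f.Monic)
    (hdeg : f.natDegree = (orbit n S).card) (h : f.map (powHom n r) = orbitPoly n S) :
    Irreducible f := by
  have hpos := card_orbit_pos (n := n) (S := S)
  have key : ∀ g k : (ConvSeries r)[X], g.Monic → k.Monic → g * k = f →
      (g.map (powHom n r)).IsRoot S → k.natDegree = 0 := by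
    intro g k hg hk hgk hroot
    have h1 := Polynomial.natDegree_le_of_dvd (orbitPoly_dvd_map_powHom hg hroot) (hg.map _).ne_zero
    rw [natDegree_orbitPoly, hg.natDegree_map] at h1
    have h2 := hg.natDegree_mul hk
    rw [hgk] at h2
    omega
  rw [hf.irreducible_iff_natDegree]
  refine ⟨fun h1 => ?_, fun g k hg hk hgk => ?_⟩
  · rw [h1, Polynomial.natDegree_one] at hdeg
    omega
  · have hS : (f.map (powHom n r)).IsRoot S := h ▸ isRoot_orbitPoly.2 self_mem_orbit
    rw [← hgk, Polynomial.map_mul, Polynomial.root_mul] at hS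
    rcases hS with hS | hS
    · exact Or.inr (key g k hg hk hgk hS)
    · exact Or.inl (key k g hk hg (by rw [mul_comm, hgk]) hS)

/-- Up to sign, the discriminant is the product of all differences of distinct conjugates, and being
a monomial times a unit passes to products and to factors. -/
theorem isMonomialUnit_discr_iff {f : (ConvSeries r)[X]} (hf : f.Monic)
    (hdeg : f.natDegree = (orbit n S).card) (h : f.map (powHom n r) = orbitPoly n S) :
    (∃ α, IsMonomialUnit α (powHom n r f.discr)) ↔
      ∀ ξ ∈ orbit n S, ∀ η ∈ orbit n S, ξ ≠ η → ∃ α, IsMonomialUnit α (ξ - η) := by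
  classical
  have hpos := card_orbit_pos (n := n) (S := S)
  have h1 := congrArg (powHom n r) (Polynomial.resultant_deriv (f := f)
    (by rw [← Polynomial.natDegree_pos_iff_degree_pos, hdeg]; exact hpos))
  rw [← Polynomial.resultant_map_map, ← Polynomial.derivative_map, h, hf.leadingCoeff, mul_one,
    hdeg, ← natDegree_orbitPoly] at h1
  have h2 : (orbitPoly n S).resultant (Polynomial.derivative (orbitPoly n S))
      (orbitPoly n S).natDegree ((orbitPoly n S).natDegree - 1) =
      ∏ ξ ∈ orbit n S, ∏ η ∈ (orbit n S).erase ξ, (ξ - η) := by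
    refine (Polynomial.resultant_prod_left _ _ _ _ (by simp)
      (Polynomial.natDegree_derivative_le _)).trans ?_
    refine Finset.prod_congr rfl fun ξ hξ => ?_
    rw [Polynomial.natDegree_X_sub_C,
      Polynomial.resultant_X_sub_C_left _ _ _ (Polynomial.natDegree_derivative_le _), orbitPoly,
      Finset.prod, Polynomial.eval_multiset_prod_X_sub_C_derivative hξ]
    rfl
  have h3 : ∀ d, (∃ α, IsMonomialUnit α (powHom n r ((-1) ^ d * f.discr))) ↔
      ∃ α, IsMonomialUnit α (powHom n r f.discr) := by
    intro d
    rcases neg_one_pow_eq_or (ConvSeries r) d with hd | hd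
    · rw [hd, one_mul]
    · rw [hd, neg_one_mul, map_neg]
      exact ⟨fun ⟨α, hα⟩ => ⟨α, neg_neg (powHom n r f.discr) ▸ hα.neg⟩,
        fun ⟨α, hα⟩ => ⟨α, hα.neg⟩⟩
  rw [← h3, ← h1, h2]
  constructor
  · rintro ⟨α, hα⟩ ξ hξ η hη hne
    refine hα.of_dvd (dvd_trans ?_ (Finset.dvd_prod_of_mem _ hξ))
    exact Finset.dvd_prod_of_mem (fun η => ξ - η) (Finset.mem_erase.2 ⟨hne.symm, hη⟩)
  · intro H
    refine IsMonomialUnit.prod fun ξ hξ => IsMonomialUnit.prod fun η hη => ?_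
    rw [Finset.mem_erase] at hη
    exact H ξ hξ η hη.2 hη.1.symm

theorem constantCoeff_coeff_of_map_powHom_eq_orbitPoly (hS : MvPowerSeries.constantCoeff S = 0)
    {f : (ConvSeries r)[X]} (h : f.map (powHom n r) = orbitPoly n S) {k : ℕ}
    (hk : k < (orbit n S).card) :
    MvPowerSeries.constantCoeff (f.coeff k : MvPowerSeries (Fin r) ℂ) = 0 := by
  rw [← constantCoeff_powHom (n := n), ← Polynomial.coeff_map, h, ← Polynomial.coeff_map, orbitPoly,
    Polynomial.map_prod]
  have : ∀ ξ ∈ orbit n S, (Polynomial.X - Polynomial.C ξ).map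
      (MvPowerSeries.constantCoeff (σ := Fin r) (R := ℂ)) = Polynomial.X := by
    intro ξ hξ
    obtain ⟨ω, rfl⟩ := mem_orbit.1 hξ
    rw [Polynomial.map_sub, Polynomial.map_X, Polynomial.map_C, constantCoeff_conj, hS, map_zero,
      sub_zero]
  rw [Finset.prod_congr rfl this, Finset.prod_const, Polynomial.coeff_X_pow, if_neg hk.ne]

/-- Conjugating back moves the second root to `S`, so only differences with `S` need to be studied.
-/
theorem exists_conj_sub_of_mem_orbit {ξ η : MvPowerSeries (Fin r) ℂ}
    (hξ : ξ ∈ orbit n S) (hη : η ∈ orbit n S) :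
    ∃ ω : Fin r → rootsOfUnity n ℂ, (ξ = η ↔ conj ω S = S) ∧
      ∀ α, IsMonomialUnit α (ξ - η) ↔ IsMonomialUnit α (conj ω S - S) := by
  obtain ⟨ω, rfl⟩ := mem_orbit.1 hξ
  obtain ⟨ω', rfl⟩ := mem_orbit.1 hη
  have h : conj (ω * ω'⁻¹) S - S = conj ω'⁻¹ (conj ω S - conj ω' S) := by
    rw [map_sub, conj_conj, conj_inv_conj]
  refine ⟨ω * ω'⁻¹, ?_, fun α => by rw [h, isMonomialUnit_conj]⟩
  rw [← sub_eq_zero, ← sub_eq_zero (b := S), h]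
  refine ⟨fun h => by rw [h, map_zero], fun h => ?_⟩
  have := congrArg (conj ω') h
  rwa [conj_conj, inv_mul_cancel, conj_one, map_zero] at this

theorem charExponents_eq (hS : IsConvergent S) {f : (ConvSeries r)[X]}
    (h : f.map (powHom n r) = orbitPoly n S) :
    charExponents n f =
      {α | ∃ ω : Fin r → rootsOfUnity n ℂ, IsMonomialUnit α (conj ω S - S)} := by
  have hb : ∀ ξ, IsBranch n f ξ ↔ ξ ∈ orbit n S := fun ξ => by
    rw [isBranch_iff, h, isRoot_orbitPoly]
    exact ⟨fun h => h.2, fun h => ⟨hS.of_mem_orbit h, h⟩⟩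
  ext α
  constructor
  · rintro ⟨ξ, η, u, hξ, hη, -, hu, he⟩
    obtain ⟨ω, -, hω⟩ := exists_conj_sub_of_mem_orbit ((hb ξ).1 hξ) ((hb η).1 hη)
    exact ⟨ω, (hω α).1 ⟨u, hu, he⟩⟩
  · rintro ⟨ω, u, hu, he⟩
    have h1 : IsConvergent (conj ω S - S) := (hS.conj ω).sub hS
    rw [he] at h1
    exact ⟨conj ω S, S, u, (hb _).2 (mem_orbit.2 ⟨ω, rfl⟩), (hb _).2 self_mem_orbit,
      h1.of_monomial_mul, hu, he⟩

/-- This removes the polynomial from the definition: `f` has to be the orbit polynomial of `S`. What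
remains are conditions on the conjugates, which can be followed through a change of coordinates. -/
theorem isQOParam_iff {lam : Fin r →₀ ℕ} : IsQOParam n lam S ↔
    IsConvergent S ∧ MvPowerSeries.constantCoeff S = 0 ∧ (orbit n S).card = n ∧
      (∀ ω : Fin r → rootsOfUnity n ℂ, conj ω S ≠ S → ∃ α, IsMonomialUnit α (conj ω S - S)) ∧
      IsLeast {α | ∃ ω : Fin r → rootsOfUnity n ℂ, IsMonomialUnit α (conj ω S - S)} lam := by
  constructor
  · rintro ⟨f, hf, hb, hl⟩
    obtain ⟨hS, hroot⟩ := isBranch_iff.1 hb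
    have hmap := map_powHom_eq_orbitPoly hS hf.monic hf.irreducible hroot
    have hcard : (orbit n S).card = n := by
      rw [← natDegree_orbitPoly, ← hmap, hf.monic.natDegree_map, hf.natDegree_eq]
    rw [charExponents_eq hS hmap] at hl
    refine ⟨hS, ?_, hcard, fun ω hω => ?_, hl⟩
    · have h1 := congrArg MvPowerSeries.constantCoeff hroot
      rw [Polynomial.eval_map, Polynomial.eval₂_eq_sum_range, map_sum, map_zero,
        Finset.sum_range_succ, Finset.sum_eq_zero, zero_add, hf.monic.coeff_natDegree, map_one,
        one_mul, map_pow] at h1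
      · exact eq_zero_of_pow_eq_zero h1
      · intro k hk
        rw [Finset.mem_range, hf.natDegree_eq] at hk
        rw [map_mul, constantCoeff_powHom, hf.weierstrass k hk, zero_mul]
    · exact (isMonomialUnit_discr_iff hf.monic (hf.natDegree_eq.trans hcard.symm) hmap).1
        (exists_isMonomialUnit_powHom_iff.2 hf.discr_eq) _ (mem_orbit.2 ⟨ω, rfl⟩) _
        self_mem_orbit hω
  · rintro ⟨hS, hS0, hcard, hdiff, hl⟩
    obtain ⟨f, hmap, hdeg, hf⟩ := exists_map_powHom_eq_orbitPoly (n := n) hS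
    refine ⟨f, ⟨hf, hdeg.trans hcard, fun k hk => ?_, ?_, ?_⟩, ?_, ?_⟩
    · exact constantCoeff_coeff_of_map_powHom_eq_orbitPoly hS0 hmap (hcard.symm ▸ hk)
    · exact irreducible_of_map_powHom_eq_orbitPoly hf hdeg hmap
    · rw [← exists_isMonomialUnit_powHom_iff (n := n), isMonomialUnit_discr_iff hf hdeg hmap]
      intro ξ hξ η hη hne
      obtain ⟨ω, h1, h2⟩ := exists_conj_sub_of_mem_orbit hξ hη
      obtain ⟨α, hα⟩ := hdiff ω (fun h => hne (h1.2 h))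
      exact ⟨α, (h2 α).2 hα⟩
    · exact isBranch_iff.2 ⟨hS, hmap ▸ isRoot_orbitPoly.2 self_mem_orbit⟩
    · rwa [charExponents_eq hS hmap]

end orbit

/-- The size of an orbit depends only on the stabilizer. -/
theorem card_orbit_eq {n r : ℕ} [NeZero n] {S S' : MvPowerSeries (Fin r) ℂ}
    (h : ∀ ω : Fin r → rootsOfUnity n ℂ, conj ω S = S ↔ conj ω S' = S') :
    (orbit n S).card = (orbit n S').card := by
  classical
  have key : ∀ {S S' : MvPowerSeries (Fin r) ℂ},
      (∀ ω : Fin r → rootsOfUnity n ℂ, conj ω S = S → conj ω S' = S') →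
      (orbit n S').card ≤ (orbit n S).card := by
    intro S S' h
    let f : (Fin r → rootsOfUnity n ℂ) → MvPowerSeries (Fin r) ℂ := fun ω => conj ω S
    let g : (Fin r → rootsOfUnity n ℂ) → MvPowerSeries (Fin r) ℂ := fun ω => conj ω S'
    have hfg : g.FactorsThrough f := by
      intro ω ω' hω
      have h1 : conj (ω * ω'⁻¹) S = S := by
        rw [← conj_conj, show conj ω S = conj ω' S from hω, conj_inv_conj]
      have h2 := congrArg (conj ω') (h _ h1)
      rwa [conj_conj, inv_mul_cancel_right] at h2
    have : orbit n S' = (orbit n S).image (Function.extend f g 0) := by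
      ext ξ
      simp only [Finset.mem_image, mem_orbit, exists_exists_eq_and]
      exact exists_congr fun ω => by rw [← show g ω = conj ω S' from rfl, ← hfg.extend_apply 0 ω]
    rw [this]
    exact Finset.card_image_le
  exact le_antisymm (key fun ω => (h ω).2) (key fun ω => (h ω).1)

/-! ### A family of equivalent parameterizations -/

theorem constantCoeff_subst_of_constantCoeff_zero {k r : ℕ} {a : Fin k → MvPowerSeries (Fin r) ℂ}
    (ha : ∀ i, MvPowerSeries.constantCoeff (a i) = 0) (f : MvPowerSeries (Fin k) ℂ) :
    MvPowerSeries.constantCoeff (MvPowerSeries.subst a f) = MvPowerSeries.constantCoeff f := by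
  have hs := MvPowerSeries.hasSubst_of_constantCoeff_zero ha
  have h1 : f = (f - MvPowerSeries.C (MvPowerSeries.constantCoeff f)) +
      MvPowerSeries.C (MvPowerSeries.constantCoeff f) := (sub_add_cancel _ _).symm
  conv_lhs => rw [h1]
  rw [MvPowerSeries.subst_add hs, map_add, MvPowerSeries.subst_C,
    MvPowerSeries.constantCoeff_subst_eq_zero hs ha (by simp), zero_add]
  simp

section param

variable {n r : ℕ} {S : MvPowerSeries (Fin r) ℂ}

@[simp]
theorem param_castSucc (i : Fin r) : param n S i.castSucc = MvPowerSeries.X i ^ n :=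
  Fin.snoc_castSucc (α := fun _ => MvPowerSeries (Fin r) ℂ) _ _ _

@[simp]
theorem param_last : param n S (Fin.last r) = S :=
  Fin.snoc_last (α := fun _ => MvPowerSeries (Fin r) ℂ) _ _

theorem constantCoeff_param [NeZero n] (hS : MvPowerSeries.constantCoeff S = 0) (l : Fin (r + 1)) :
    MvPowerSeries.constantCoeff (param n S l) = 0 := by
  refine Fin.lastCases ?_ (fun i => ?_) l
  · rw [param_last, hS]
  · rw [param_castSucc, map_pow, MvPowerSeries.constantCoeff_X, zero_pow (NeZero.ne n)]

theorem isConvergent_param (hS : IsConvergent S) (l : Fin (r + 1)) :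
    IsConvergent (param n S l) := by
  refine Fin.lastCases ?_ (fun i => ?_) l
  · rwa [param_last]
  · rw [param_castSucc]
    exact (isConvergent_X i).pow n

theorem sub_dvd_subst_param_sub [NeZero n] {S' : MvPowerSeries (Fin r) ℂ}
    (hS' : MvPowerSeries.constantCoeff S' = 0)
    (f : MvPowerSeries (Fin (r + 1)) ℂ) : S - S' ∣ MvPowerSeries.subst (param n S) f -
      MvPowerSeries.subst (param n S') f := by
  refine dvd_subst_sub_subst (constantCoeff_param hS') (fun l => ?_) f
  refine Fin.lastCases ?_ (fun i => ?_) l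
  · simp
  · simp

end param

theorem conj_eq_subst {n r : ℕ} (ω : Fin r → rootsOfUnity n ℂ) (S : MvPowerSeries (Fin r) ℂ) :
    conj ω S = MvPowerSeries.subst
      (fun i => MvPowerSeries.C ((ω i : ℂˣ) : ℂ) * MvPowerSeries.X i) S := by
  rw [conj, MvPowerSeries.rescale_eq_subst]
  congr 1
  ext1 i
  rw [← MvPowerSeries.smul_eq_C_mul]
  rfl

theorem conj_subst_param {n r : ℕ} [NeZero n] {S : MvPowerSeries (Fin r) ℂ}
    (hS : MvPowerSeries.constantCoeff S = 0) (ω : Fin r → rootsOfUnity n ℂ)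
    (f : MvPowerSeries (Fin (r + 1)) ℂ) :
    conj ω (MvPowerSeries.subst (param n S) f) = MvPowerSeries.subst (param n (conj ω S)) f := by
  have hω : MvPowerSeries.HasSubst
      (fun i => MvPowerSeries.C ((ω i : ℂˣ) : ℂ) * MvPowerSeries.X i :
        Fin r → MvPowerSeries (Fin r) ℂ) :=
    MvPowerSeries.hasSubst_of_constantCoeff_zero fun i => by simp
  rw [conj_eq_subst, MvPowerSeries.subst_comp_subst_apply
    (MvPowerSeries.hasSubst_of_constantCoeff_zero (constantCoeff_param hS)) hω]
  congr 1
  ext1 l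
  refine Fin.lastCases ?_ (fun i => ?_) l
  · rw [param_last, param_last, conj_eq_subst]
  · rw [param_castSucc, param_castSucc, MvPowerSeries.subst_pow hω, MvPowerSeries.subst_X hω,
      mul_pow, ← map_pow, ← Units.val_pow_eq_pow_val, (mem_rootsOfUnity n _).1 (ω i).2,
      Units.val_one, map_one, one_mul]

/-- The coordinate change `t_j ↦ t_j Θ^w`. -/
noncomputable def scaleVar {r : ℕ} (j : Fin r) (w : ℕ) (Θ : MvPowerSeries (Fin r) ℂ) :
    Fin r → MvPowerSeries (Fin r) ℂ :=
  fun i => MvPowerSeries.X i * if i = j then Θ ^ w else 1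

theorem constantCoeff_scaleVar {r : ℕ} (j : Fin r) (w : ℕ) (Θ : MvPowerSeries (Fin r) ℂ)
    (i : Fin r) : MvPowerSeries.constantCoeff (scaleVar j w Θ i) = 0 := by
  rw [scaleVar, map_mul, MvPowerSeries.constantCoeff_X, zero_mul]

/-- The coordinate change `X_j ↦ X_j θ^w`, `X_{r+1} ↦ X_{r+1} θ^k`. -/
noncomputable def scaleVarLast {r : ℕ} (j : Fin r) (w k : ℕ) (θ : MvPowerSeries (Fin (r + 1)) ℂ) :
    Fin (r + 1) → MvPowerSeries (Fin (r + 1)) ℂ :=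
  fun l => MvPowerSeries.X l * if l = j.castSucc then θ ^ w else if l = Fin.last r then θ ^ k else 1

theorem isGermIso_of_eq_X_mul' {k : ℕ} {φ e : Fin k → MvPowerSeries (Fin k) ℂ}
    (he : ∀ i, IsConvergent (e i)) (he0 : ∀ i, MvPowerSeries.constantCoeff (e i) = 1)
    (hφ : ∀ i, φ i = MvPowerSeries.X i * e i) : IsGermIso φ :=
  isGermIso_of_eq_X_mul (e := fun i => e i - 1) (fun i => (he i).sub isConvergent_one)
    (fun i => by rw [map_sub, he0, map_one, sub_self]) fun i => by rw [hφ, add_sub_cancel]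

section scaleVar

variable {n r : ℕ} {j : Fin r} {w k : ℕ}

theorem isConvergent_scaleVar_factor {Θ : MvPowerSeries (Fin r) ℂ} (hΘ : IsConvergent Θ)
    (i : Fin r) : IsConvergent (if i = j then Θ ^ w else 1) := by
  split_ifs
  exacts [hΘ.pow w, isConvergent_one]

theorem constantCoeff_scaleVar_factor {Θ : MvPowerSeries (Fin r) ℂ}
    (hΘ : MvPowerSeries.constantCoeff Θ = 1) (i : Fin r) :
    MvPowerSeries.constantCoeff (if i = j then Θ ^ w else 1) = 1 := by
  split_ifs <;> simp [hΘ]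

theorem isGermIso_scaleVar {Θ : MvPowerSeries (Fin r) ℂ} (hΘ : IsConvergent Θ)
    (hΘ0 : MvPowerSeries.constantCoeff Θ = 1) : IsGermIso (scaleVar j w Θ) :=
  isGermIso_of_eq_X_mul' (isConvergent_scaleVar_factor hΘ) (constantCoeff_scaleVar_factor hΘ0)
    fun _ => rfl

/-- Every component is a variable times a unit with constant term 1, so all `η` are 0 and no
condition on `lam` arises. -/
theorem memATilde_scaleVar {lam : Fin r →₀ ℕ} {θ : MvPowerSeries (Fin (r + 1)) ℂ}
    (hθ : IsConvergent θ) (hθ0 : MvPowerSeries.constantCoeff θ = 1)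
    {Θ : MvPowerSeries (Fin r) ℂ} (hΘ : IsConvergent Θ)
    (hΘ0 : MvPowerSeries.constantCoeff Θ = 1) :
    MemATilde n lam (scaleVarLast j (n * w) k θ) (scaleVar j w Θ) := by
  have hc : ∀ l : Fin (r + 1), IsConvergent (if l = j.castSucc then θ ^ (n * w) else
      if l = Fin.last r then θ ^ k else 1) := by
    intro l
    split_ifs
    exacts [hθ.pow _, hθ.pow _, isConvergent_one]
  have hc0 : ∀ l : Fin (r + 1), MvPowerSeries.constantCoeff (if l = j.castSucc then θ ^ (n * w) else
      if l = Fin.last r then θ ^ k else 1) = 1 := by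
    intro l
    split_ifs <;> simp [hθ0]
  refine ⟨isGermIso_of_eq_X_mul' hc hc0 fun _ => rfl, isGermIso_scaleVar hΘ hΘ0, fun i => ?_,
    fun i => ?_, ?_⟩
  · refine ⟨1, (if i = j then Θ ^ w else 1) - 1, one_ne_zero,
      (isConvergent_scaleVar_factor hΘ i).sub isConvergent_one, ?_, ?_⟩
    · rw [map_sub, constantCoeff_scaleVar_factor hΘ0, map_one, sub_self]
    · rw [map_one, add_sub_cancel]
      rfl
  · refine ⟨1, _, 0, one_ne_zero, (hc i.castSucc).sub isConvergent_one, ?_,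
      (ConvSeries (r + 1)).zero_mem, fun _ => rfl, ?_⟩
    · rw [map_sub, hc0, map_one, sub_self]
    · rw [map_one, scaleVarLast]
      ring
  · refine ⟨1, _, 0, one_ne_zero, (hc (Fin.last r)).sub isConvergent_one, ?_,
      (ConvSeries (r + 1)).zero_mem, ?_⟩
    · rw [map_sub, hc0, map_one, sub_self]
    · rw [map_one, scaleVarLast]
      ring

/-- The exponent `n w` is forced by `(t_j Θ^w)^n = t_j^n Θ^(n w)`; it keeps the first components
equal to `t_i^n`. -/
theorem subst_param_scaleVarLast [NeZero n] {S S' : MvPowerSeries (Fin r) ℂ}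
    (hS : MvPowerSeries.constantCoeff S = 0) (θ : MvPowerSeries (Fin (r + 1)) ℂ)
    (hS' : MvPowerSeries.subst (scaleVar j w (MvPowerSeries.subst (param n S) θ)) S' =
      S * MvPowerSeries.subst (param n S) θ ^ k) (l : Fin (r + 1)) :
    MvPowerSeries.subst (param n S) (scaleVarLast j (n * w) k θ l) =
      MvPowerSeries.subst (scaleVar j w (MvPowerSeries.subst (param n S) θ)) (param n S' l) := by
  have hp := MvPowerSeries.hasSubst_of_constantCoeff_zero (constantCoeff_param (n := n) hS)
  have hρ : MvPowerSeries.HasSubst (scaleVar j w (MvPowerSeries.subst (param n S) θ)) :=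
    MvPowerSeries.hasSubst_of_constantCoeff_zero (constantCoeff_scaleVar _ _ _)
  have h1 : MvPowerSeries.subst (param n S) (1 : MvPowerSeries (Fin (r + 1)) ℂ) = 1 := by
    rw [← MvPowerSeries.substAlgHom_apply hp, map_one]
  rw [scaleVarLast, MvPowerSeries.subst_mul hp, MvPowerSeries.subst_X hp]
  refine Fin.lastCases ?_ (fun i => ?_) l
  · rw [param_last, param_last, hS', if_neg (Fin.castSucc_lt_last j).ne', if_pos rfl,
      MvPowerSeries.subst_pow hp]
  · rw [param_castSucc, param_castSucc, MvPowerSeries.subst_pow hρ, MvPowerSeries.subst_X hρ,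
      scaleVar, mul_pow]
    congr 1
    by_cases hij : i = j
    · rw [if_pos (congrArg _ hij), if_pos hij, MvPowerSeries.subst_pow hp, ← pow_mul, mul_comm n]
    · rw [if_neg (fun h => hij (Fin.castSucc_injective _ h)), if_neg (Fin.castSucc_lt_last i).ne,
        if_neg hij, h1, one_pow]

/-- The differences of conjugates of `S'` are, up to units and a change of coordinates, those of the
conjugates of `S`. -/
theorem exists_conj_sub_eq_subst [NeZero n] {S : MvPowerSeries (Fin r) ℂ}
    (hS : MvPowerSeries.constantCoeff S = 0) {θ : MvPowerSeries (Fin (r + 1)) ℂ}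
    {Θ : MvPowerSeries (Fin r) ℂ} (hΘ : Θ = MvPowerSeries.subst (param n S) θ)
    (hΘ0 : MvPowerSeries.constantCoeff Θ = 1)
    {ψ : Fin r → MvPowerSeries (Fin r) ℂ} (hψ0 : ∀ i, MvPowerSeries.constantCoeff (ψ i) = 0)
    (hψ : ∀ i, MvPowerSeries.subst ψ (scaleVar j w Θ i) = MvPowerSeries.X i)
    (hρψ : ∀ i, MvPowerSeries.subst (scaleVar j w Θ) (ψ i) = MvPowerSeries.X i)
    (ω : Fin r → rootsOfUnity n ℂ) :
    ∃ U, MvPowerSeries.constantCoeff U = 1 ∧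
      conj ω (MvPowerSeries.subst ψ (S * Θ ^ k)) - MvPowerSeries.subst ψ (S * Θ ^ k) =
        MvPowerSeries.subst ψ ((conj ω S - S) * U) := by
  set ρ := scaleVar j w Θ with hρ
  have hρ0 : ∀ i, MvPowerSeries.constantCoeff (ρ i) = 0 := constantCoeff_scaleVar _ _ _
  have sρ := MvPowerSeries.hasSubst_of_constantCoeff_zero hρ0
  have sψ := MvPowerSeries.hasSubst_of_constantCoeff_zero hψ0
  let z : Fin r → MvPowerSeries (Fin r) ℂ := fun i => MvPowerSeries.C ((ω i : ℂˣ) : ℂ)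
  let a : Fin r → MvPowerSeries (Fin r) ℂ := fun i => z i * MvPowerSeries.X i
  have ha0 : ∀ i, MvPowerSeries.constantCoeff (a i) = 0 := fun i => by simp [a]
  have sa := MvPowerSeries.hasSubst_of_constantCoeff_zero ha0
  let b : Fin r → MvPowerSeries (Fin r) ℂ := fun i => z i * ρ i
  have hb0 : ∀ i, MvPowerSeries.constantCoeff (b i) = 0 := fun i => by simp [b, hρ0]
  have sb := MvPowerSeries.hasSubst_of_constantCoeff_zero hb0
  -- `t = ψ ∘ ω ∘ ρ` is conjugation by `ω` seen in the old coordinates; it satisfies `ρ ∘ t = ω ρ`.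
  -- Conjugating `S'` amounts to substituting `t` in `S Θ^k`.
  let t : Fin r → MvPowerSeries (Fin r) ℂ := fun i => MvPowerSeries.subst b (ψ i)
  have ht0 : ∀ i, MvPowerSeries.constantCoeff (t i) = 0 := fun i => by
    simp only [t, constantCoeff_subst_of_constantCoeff_zero hb0, hψ0]
  have st := MvPowerSeries.hasSubst_of_constantCoeff_zero ht0
  have htρ : ∀ i, MvPowerSeries.subst t (ρ i) = z i * ρ i := by
    intro i
    rw [← MvPowerSeries.subst_comp_subst_apply sψ sb, hψ, MvPowerSeries.subst_X sb]
  set Θ' := MvPowerSeries.subst t Θ with hΘ'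
  have hΘ'0 : MvPowerSeries.constantCoeff Θ' = 1 := by
    rw [hΘ', constantCoeff_subst_of_constantCoeff_zero ht0, hΘ0]
  have hΘ'u : IsUnit (Θ' ^ w) := by
    refine IsUnit.pow _ (MvPowerSeries.isUnit_iff_constantCoeff.2 ?_)
    rw [hΘ'0]
    exact isUnit_one
  set E := conj ω S - S with hE
  -- Only the `j`-th coordinate differs from plain conjugation, and there `t_j Θ'^w = ω_j X_j Θ^w`.
  have hsub : ∀ i, MvPowerSeries.X j * (Θ' - Θ) ∣ t i - a i := by
    intro i
    have h1 := htρ i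
    rw [hρ, scaleVar, MvPowerSeries.subst_mul st, MvPowerSeries.subst_X st] at h1
    by_cases hij : i = j
    · subst hij
      rw [if_pos rfl, MvPowerSeries.subst_pow st, ← hΘ'] at h1
      rw [← hΘ'u.dvd_mul_right]
      have h2 : (t i - a i) * Θ' ^ w = MvPowerSeries.X i * (Θ' ^ w - Θ ^ w) * (- z i) := by
        rw [sub_mul, h1]
        simp only [a]
        ring
      rw [h2]
      exact Dvd.dvd.mul_right (mul_dvd_mul_left _ (sub_dvd_pow_sub_pow _ _ _)) _
    · rw [if_neg hij, mul_one, ← MvPowerSeries.substAlgHom_apply st, map_one, mul_one] at h1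
      rw [show t i = a i from h1, sub_self]
      exact dvd_zero _
  have hSt : MvPowerSeries.X j * (Θ' - Θ) ∣ MvPowerSeries.subst t S - conj ω S := by
    rw [conj_eq_subst]
    exact dvd_subst_sub_subst ha0 hsub S
  have hcS : MvPowerSeries.constantCoeff (conj ω S) = 0 := by rw [constantCoeff_conj, hS]
  -- `Θ` is a pullback along the parameterization, whose first components `X_i^n` do not see `ω`.
  -- Modulo this divisor, `Θ'` is therefore `θ` evaluated at the conjugate parameterization.
  have hD1 : MvPowerSeries.X j * (Θ' - Θ) ∣
      Θ' - MvPowerSeries.subst (param n (conj ω S)) θ := by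
    have h0 : Θ' = MvPowerSeries.subst (fun l => MvPowerSeries.subst t (param n S l)) θ := by
      rw [hΘ', hΘ, MvPowerSeries.subst_comp_subst_apply
        (MvPowerSeries.hasSubst_of_constantCoeff_zero (constantCoeff_param hS)) st]
    have h1 : ∀ i, a i ^ n = MvPowerSeries.X i ^ n := by
      intro i
      simp only [a, z]
      rw [mul_pow, ← map_pow, ← Units.val_pow_eq_pow_val, (mem_rootsOfUnity n _).1 (ω i).2,
        Units.val_one, map_one, one_mul]
    have h2 : ∀ l, MvPowerSeries.X j * (Θ' - Θ) ∣
        MvPowerSeries.subst t (param n S l) - param n (conj ω S) l := by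
      intro l
      refine Fin.lastCases ?_ (fun i => ?_) l
      · rw [param_last, param_last]
        exact hSt
      · rw [param_castSucc, param_castSucc, MvPowerSeries.subst_pow st, MvPowerSeries.subst_X st,
          ← h1]
        exact (hsub i).trans (sub_dvd_pow_sub_pow _ _ _)
    have h3 := dvd_subst_sub_subst (constantCoeff_param hcS) h2 θ
    rwa [← h0] at h3
  have hD2 : E ∣ MvPowerSeries.subst (param n (conj ω S)) θ - Θ := by
    rw [hΘ]
    exact sub_dvd_subst_param_sub hS θ
  obtain ⟨A, hA⟩ := hD1
  obtain ⟨B, hB⟩ := hD2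
  obtain ⟨A₂, hA₂⟩ := hSt
  -- Adding the two comparisons gives `(Θ' - Θ)(1 - X_j A) = E B`. The factor `X_j` makes the
  -- bracket a unit, so `E` divides `Θ' - Θ`.
  have hu : IsUnit (1 - MvPowerSeries.X j * A) := by
    rw [MvPowerSeries.isUnit_iff_constantCoeff]
    simp
  have hED : E ∣ Θ' - Θ := by
    rw [← hu.dvd_mul_right]
    refine ⟨B, ?_⟩
    rw [← hB]
    linear_combination hA
  obtain ⟨G, hG⟩ := hED
  obtain ⟨P, hP⟩ := sub_dvd_pow_sub_pow Θ' Θ k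
  -- This is the quotient of `S(t) Θ'^k - S Θ^k` by `E`, using `S(t) = S + E + X_j E G A₂` and `Θ'^k
  -- - Θ^k = E G P`. Its constant term is 1 because `S` vanishes at the origin.
  refine ⟨(1 + MvPowerSeries.X j * (G * A₂)) * Θ' ^ k + S * (G * P), ?_, ?_⟩
  · simp [hΘ'0, hS]
  · have h1 : ∀ f, MvPowerSeries.subst ρ (MvPowerSeries.subst ψ f) = f :=
      subst_subst_eq_self sψ sρ hρψ
    have h2 : ∀ f, MvPowerSeries.subst ψ (MvPowerSeries.subst ρ f) = f :=
      subst_subst_eq_self sρ sψ hψ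
    have h3 : MvPowerSeries.subst ρ (conj ω (MvPowerSeries.subst ψ (S * Θ ^ k))) =
        MvPowerSeries.subst t S * Θ' ^ k := by
      rw [conj_eq_subst, MvPowerSeries.subst_comp_subst_apply sa sρ]
      have h4 : (fun s => MvPowerSeries.subst ρ (a s)) = b := by
        ext1 i
        simp only [a, z, b]
        rw [MvPowerSeries.subst_mul sρ, MvPowerSeries.subst_X sρ, MvPowerSeries.subst_C]
      rw [show (fun s => MvPowerSeries.subst ρ
          (MvPowerSeries.C ((ω s : ℂˣ) : ℂ) * MvPowerSeries.X s)) = b from h4,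
        MvPowerSeries.subst_comp_subst_apply sψ sb, MvPowerSeries.subst_mul st,
        MvPowerSeries.subst_pow st]
    rw [← h2 (conj ω (MvPowerSeries.subst ψ (S * Θ ^ k)) - MvPowerSeries.subst ψ (S * Θ ^ k)),
      MvPowerSeries.subst_sub sρ, h1, h3]
    congr 1
    have h5 : MvPowerSeries.subst t S = S + E + MvPowerSeries.X j * (Θ' - Θ) * A₂ := by
      rw [← hA₂, hE]
      ring
    rw [h5, hG]
    rw [hG] at hP
    linear_combination S * hP

/-- Units and substitutions `t_i ↦ t_i · unit` do not change the exponent of a monomial times a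
unit. Hence stabilizers, orbit size and characteristic exponents all agree. -/
theorem isQOParam_of_conj_sub_eq_subst [NeZero n] {lam : Fin r →₀ ℕ}
    {S S' : MvPowerSeries (Fin r) ℂ} (hS : IsQOParam n lam S) (hc : IsConvergent S')
    (hc0 : MvPowerSeries.constantCoeff S' = 0) {ψ e : Fin r → MvPowerSeries (Fin r) ℂ}
    (hψ : ∀ i, ψ i = MvPowerSeries.X i * e i) (he : ∀ i, MvPowerSeries.constantCoeff (e i) ≠ 0)
    (h : ∀ ω : Fin r → rootsOfUnity n ℂ, ∃ U, MvPowerSeries.constantCoeff U = 1 ∧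
      conj ω S' - S' = MvPowerSeries.subst ψ ((conj ω S - S) * U)) : IsQOParam n lam S' := by
  obtain ⟨-, -, hcard, hdiff, hl⟩ := isQOParam_iff.1 hS
  have sψ : MvPowerSeries.HasSubst ψ :=
    MvPowerSeries.hasSubst_of_constantCoeff_zero fun i => by simp [hψ]
  have h1 : ∀ (ω : Fin r → rootsOfUnity n ℂ) α, IsMonomialUnit α (conj ω S - S) →
      IsMonomialUnit α (conj ω S' - S') := by
    intro ω α hα
    obtain ⟨U, hU, hUe⟩ := h ω
    rw [hUe]
    exact (hα.mul_unit (by rw [hU]; exact one_ne_zero)).subst hψ he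
  have h2 : ∀ ω : Fin r → rootsOfUnity n ℂ, conj ω S = S ↔ conj ω S' = S' := by
    intro ω
    constructor
    · intro hω
      obtain ⟨U, -, hUe⟩ := h ω
      rw [hω, sub_self, zero_mul, ← MvPowerSeries.substAlgHom_apply sψ, map_zero] at hUe
      exact sub_eq_zero.1 hUe
    · intro hω
      by_contra hne
      obtain ⟨α, hα⟩ := hdiff ω hne
      exact (h1 ω α hα).ne_zero (sub_eq_zero.2 hω)
  refine isQOParam_iff.2 ⟨hc, hc0, (card_orbit_eq h2).symm.trans hcard, fun ω hω => ?_, ?_⟩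
  · obtain ⟨α, hα⟩ := hdiff ω fun h => hω ((h2 ω).1 h)
    exact ⟨α, h1 ω α hα⟩
  · convert hl using 2
    ext α
    refine exists_congr fun ω => ⟨fun hα => ?_, h1 ω α⟩
    have hne : conj ω S ≠ S := fun h => hα.ne_zero (sub_eq_zero.2 ((h2 ω).1 h))
    obtain ⟨β, hβ⟩ := hdiff ω hne
    rwa [hα.unique (h1 ω β hβ)]

theorem exists_aTildeEquiv_param [NeZero n] {lam : Fin r →₀ ℕ} {S : MvPowerSeries (Fin r) ℂ}
    (hS : IsQOParam n lam S) {θ : MvPowerSeries (Fin (r + 1)) ℂ} (hθ : IsConvergent θ)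
    (hθ0 : MvPowerSeries.constantCoeff θ = 1) (j : Fin r) (w k : ℕ) :
    ∃ ψ : Fin r → MvPowerSeries (Fin r) ℂ, (∀ i, MvPowerSeries.constantCoeff (ψ i) = 0) ∧
      (∀ i, ψ i * (if i = j then
        MvPowerSeries.subst ψ (MvPowerSeries.subst (param n S) θ) ^ w else 1) =
          MvPowerSeries.X i) ∧
      IsQOParam n lam (MvPowerSeries.subst ψ (S * MvPowerSeries.subst (param n S) θ ^ k)) ∧
      ATildeEquiv n lam (param n S)
        (param n (MvPowerSeries.subst ψ (S * MvPowerSeries.subst (param n S) θ ^ k))) := by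
  obtain ⟨hSc, hS0, -⟩ := isQOParam_iff.1 hS
  set Θ := MvPowerSeries.subst (param n S) θ with hΘ
  have hΘc : IsConvergent Θ := hθ.subst (isConvergent_param hSc) (constantCoeff_param hS0)
  have hΘ0 : MvPowerSeries.constantCoeff Θ = 1 := by
    rw [hΘ, constantCoeff_subst_of_constantCoeff_zero (constantCoeff_param hS0), hθ0]
  obtain ⟨-, ψ, hψ, hψρ, hρψ⟩ := isGermIso_scaleVar (j := j) (w := w) hΘc hΘ0
  have sψ := MvPowerSeries.hasSubst_of_constantCoeff_zero fun i => (hψ i).2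
  have sρ : MvPowerSeries.HasSubst (scaleVar j w Θ) :=
    MvPowerSeries.hasSubst_of_constantCoeff_zero (constantCoeff_scaleVar _ _ _)
  let g : Fin r → MvPowerSeries (Fin r) ℂ := fun i =>
    if i = j then MvPowerSeries.subst ψ Θ ^ w else 1
  have hmul : ∀ i, ψ i * g i = MvPowerSeries.X i := by
    intro i
    rw [← hψρ i, scaleVar, MvPowerSeries.subst_mul sψ, MvPowerSeries.subst_X sψ]
    congr 1
    simp only [g]
    split_ifs
    · rw [MvPowerSeries.subst_pow sψ]
    · rw [← MvPowerSeries.substAlgHom_apply sψ, map_one]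
  have hg0 : ∀ i, MvPowerSeries.constantCoeff (g i) = 1 := by
    intro i
    simp only [g]
    split_ifs
    · rw [map_pow, constantCoeff_subst_of_constantCoeff_zero (fun i => (hψ i).2), hΘ0, one_pow]
    · exact map_one _
  have hψe : ∀ i, ψ i = MvPowerSeries.X i * (g i)⁻¹ := by
    intro i
    rw [← hmul i, mul_assoc, MvPowerSeries.mul_inv_cancel _ (by rw [hg0]; exact one_ne_zero),
      mul_one]
  refine ⟨ψ, fun i => (hψ i).2, hmul, ?_, ?_⟩
  · refine isQOParam_of_conj_sub_eq_subst hS ?_ ?_ hψe (fun i => ?_)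
      (exists_conj_sub_eq_subst hS0 hΘ hΘ0 (fun i => (hψ i).2) hψρ hρψ)
    · exact (hSc.mul (hΘc.pow k)).subst (fun i => (hψ i).1) fun i => (hψ i).2
    · rw [constantCoeff_subst_of_constantCoeff_zero (fun i => (hψ i).2), map_mul, hS0, zero_mul]
    · rw [MvPowerSeries.constantCoeff_inv, hg0, inv_one]
      exact one_ne_zero
  · refine ⟨_, _, memATilde_scaleVar (j := j) (w := w) (k := k) hθ hθ0 hΘc hΘ0, ?_⟩
    exact subst_param_scaleVarLast hS0 θ (subst_subst_eq_self sψ sρ hρψ _)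

end scaleVar

/-! ### Coefficients modulo higher terms -/

/-- The exponents that are not strictly above `γ`. -/
def notAbove {r : ℕ} (γ : Fin r →₀ ℕ) : LowerSet (Fin r →₀ ℕ) :=
  ⟨{m | ¬ γ < m}, fun _ _ hle hm h => hm (h.trans_le hle)⟩

section higher

variable {r : ℕ} {γ : Fin r →₀ ℕ}

theorem IsMonomialUnit.sub_mem_vanishIdeal {q : MvPowerSeries (Fin r) ℂ}
    (hq : IsMonomialUnit γ q) :
    q - MvPowerSeries.monomial γ (MvPowerSeries.coeff γ q) ∈ vanishIdeal (notAbove γ) := by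
  classical
  intro m hm
  rw [map_sub, MvPowerSeries.coeff_monomial]
  split_ifs with h
  · rw [h, sub_self]
  · rw [sub_zero]
    by_contra hne
    exact hm (lt_of_le_of_ne ((isMonomialUnit_iff.1 hq).2 m hne) (Ne.symm h))

/-- A series starting at `γ`, once multiplied by one without constant term, has only exponents
strictly above `γ`. This makes `q` square-zero in the quotient when `γ ≠ 0`. -/
theorem mul_mem_vanishIdeal_of_constantCoeff {q g : MvPowerSeries (Fin r) ℂ}
    (hq : IsMonomialUnit γ q) (hg : MvPowerSeries.constantCoeff g = 0) :
    q * g ∈ vanishIdeal (notAbove γ) := by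
  obtain ⟨u, -, rfl⟩ := hq
  intro m hm
  rw [mul_assoc, MvPowerSeries.coeff_monomial_mul]
  split_ifs with h
  · have : γ = m := by
      by_contra hne
      exact hm (lt_of_le_of_ne h hne)
    rw [this, tsub_self, MvPowerSeries.coeff_zero_eq_constantCoeff_apply, map_mul, hg, mul_zero,
      mul_zero]
  · rfl

theorem mul_sub_mem_vanishIdeal {q g : MvPowerSeries (Fin r) ℂ} (hq : IsMonomialUnit γ q) :
    q * g - MvPowerSeries.C (MvPowerSeries.constantCoeff g) * q ∈ vanishIdeal (notAbove γ) := by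
  convert mul_mem_vanishIdeal_of_constantCoeff hq
    (g := g - MvPowerSeries.C (MvPowerSeries.constantCoeff g)) (by simp) using 1
  ring

end higher

/-- After factoring out `t^δ`, it is enough to know the cofactor modulo exponents strictly above
`γ`. -/
theorem IsEliminable.of_congr {n r : ℕ} {lam δ γ : Fin r →₀ ℕ} {b : ℂ}
    {S S' M u W : MvPowerSeries (Fin r) ℂ} (hS : S = M + MvPowerSeries.monomial δ b * u)
    (hS' : S' = M + MvPowerSeries.monomial δ b * W) (hM : MvPowerSeries.coeff (δ + γ) M = 0)
    {e : ℂ} (hW : W - (u + MvPowerSeries.monomial γ e) ∈ vanishIdeal (notAbove γ))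
    (he : MvPowerSeries.coeff γ u + e = 0) (hqo : IsQOParam n lam S')
    (hequiv : ATildeEquiv n lam (param n S) (param n S')) : IsEliminable n lam S (δ + γ) := by
  classical
  have hcoeff : ∀ m, ¬ γ < m → MvPowerSeries.coeff m W =
      MvPowerSeries.coeff m u + MvPowerSeries.coeff m (MvPowerSeries.monomial γ e) := by
    intro m hm
    have h1 := hW m hm
    rwa [map_sub, sub_eq_zero, map_add] at h1
  refine ⟨S', hqo, hequiv, ?_, fun β hβ hβ' => ?_⟩
  · rw [hS', map_add, hM, MvPowerSeries.coeff_add_monomial_mul, hcoeff γ (lt_irrefl γ),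
      MvPowerSeries.coeff_monomial_same, he, mul_zero, add_zero]
  · rw [hS, hS', map_add, map_add, MvPowerSeries.coeff_monomial_mul,
      MvPowerSeries.coeff_monomial_mul]
    split_ifs with h
    · obtain ⟨m, rfl⟩ := exists_add_of_le h
      rw [add_tsub_cancel_left]
      have hm : m ≠ γ := fun h => hβ (h ▸ rfl)
      rw [hcoeff m fun hlt => hβ' (add_lt_add_right hlt δ), MvPowerSeries.coeff_monomial_ne hm,
        add_zero]
    · rfl

/-! ### Elimination of the term at `δ + γ`, in the two cases -/

section lam

variable {n r : ℕ} [NeZero n] {lam : Fin r →₀ ℕ} {S : MvPowerSeries (Fin r) ℂ}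

theorem coeff_conj_sub {n r : ℕ} (ω : Fin r → rootsOfUnity n ℂ) (S : MvPowerSeries (Fin r) ℂ)
    (m : Fin r →₀ ℕ) : MvPowerSeries.coeff m (conj ω S - S) =
      ((m.prod fun i k => ((ω i : ℂˣ) : ℂ) ^ k) - 1) * MvPowerSeries.coeff m S := by
  rw [map_sub, coeff_conj]
  ring

theorem coeff_lam_ne_zero (hS : IsQOParam n lam S) : MvPowerSeries.coeff lam S ≠ 0 := by
  obtain ⟨-, -, -, -, ⟨ω, hω⟩, -⟩ := isQOParam_iff.1 hS
  have h1 := (isMonomialUnit_iff.1 hω).1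
  rw [coeff_conj_sub] at h1
  exact right_ne_zero_of_mul h1

/-- If `δ ≠ lam` is the exponent of a term of `S`, then `lam - δ` is not in the semigroup. -/
theorem lam_ne_add (hS : IsQOParam n lam S) {δ γ : Fin r →₀ ℕ}
    (hδ : MvPowerSeries.coeff δ S ≠ 0) {h : MvPowerSeries (Fin (r + 1)) ℂ}
    (hγ : IsMonomialUnit γ (MvPowerSeries.subst (param n S) h)) (hγ0 : γ ≠ 0) :
    lam ≠ δ + γ := by
  intro hlam
  obtain ⟨-, hS0, -, -, ⟨ω, hω⟩, -⟩ := isQOParam_iff.1 hS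
  obtain ⟨h1, h2⟩ := isMonomialUnit_iff.1 hω
  have hδ0 : δ ≠ 0 := by
    rintro rfl
    exact hδ hS0
  let χ : (Fin r →₀ ℕ) → ℂ := fun m => m.prod fun i k => ((ω i : ℂˣ) : ℂ) ^ k
  have hadd : χ (δ + γ) = χ δ * χ γ :=
    Finsupp.prod_add_index' (fun i => pow_zero _) fun i => pow_add _
  have hlt : ¬ lam ≤ δ := fun hle => hγ0 (by
    rw [hlam] at hle
    ext i
    have := hle i
    simp only [Finsupp.add_apply, Finsupp.zero_apply] at this ⊢
    omega)
  -- Otherwise `δ` would be an exponent of `conj ω S - S`, hence `⪰ lam`, although it lies strictly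
  -- below `lam`. As `χ lam ≠ 1`, the character must be nontrivial on `γ`.
  have hχδ : χ δ = 1 := by
    by_contra hne
    refine hlt (h2 δ ?_)
    rw [coeff_conj_sub]
    exact mul_ne_zero (sub_ne_zero.2 hne) hδ
  have hχγ : χ γ ≠ 1 := by
    intro heq
    apply h1
    have : χ lam = 1 := by rw [hlam, hadd, hχδ, heq, one_mul]
    rw [coeff_conj_sub]
    exact mul_eq_zero_of_left (sub_eq_zero.2 this) _
  -- The difference of the pullback of `h` and its conjugate has a term at `γ` and is a multiple of
  -- `conj ω S - S`, which starts at `lam`. So `lam ≤ γ`, which forces `δ = 0`, whereas `S` has no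
  -- constant term.
  obtain ⟨c, hc⟩ := sub_dvd_subst_param_sub (n := n) (S := conj ω S) hS0 h
  rw [← conj_subst_param hS0] at hc
  obtain ⟨u, -, hu⟩ := hω
  have h3 : MvPowerSeries.coeff γ (conj ω (MvPowerSeries.subst (param n S) h) -
      MvPowerSeries.subst (param n S) h) ≠ 0 := by
    rw [coeff_conj_sub]
    exact mul_ne_zero (sub_ne_zero.2 hχγ) (isMonomialUnit_iff.1 hγ).1
  rw [hc, hu, mul_assoc, MvPowerSeries.coeff_monomial_mul] at h3
  have hle : lam ≤ γ := by
    by_contra hnle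
    exact h3 (if_neg hnle)
  refine hδ0 ?_
  rw [hlam] at hle
  ext i
  have := hle i
  simp only [Finsupp.add_apply, Finsupp.zero_apply] at this ⊢
  omega

theorem IsMonomialUnit.constantCoeff_eq_zero {γ : Fin r →₀ ℕ} (hγ0 : γ ≠ 0)
    {q : MvPowerSeries (Fin r) ℂ} (hq : IsMonomialUnit γ q) :
    MvPowerSeries.constantCoeff q = 0 := by
  by_contra hne
  exact hγ0 (le_antisymm ((isMonomialUnit_iff.1 hq).2 0 hne) (zero_le))

theorem exists_aTildeEquiv_of_isMonomialUnit (hS : IsQOParam n lam S) {γ : Fin r →₀ ℕ}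
    {h : MvPowerSeries (Fin (r + 1)) ℂ}
    (hc : IsConvergent h) {q : MvPowerSeries (Fin r) ℂ}
    (hq : q = MvPowerSeries.subst (param n S) h) (hγ : IsMonomialUnit γ q)
    (hγ0 : γ ≠ 0) (c : ℂ) (j : Fin r) (w k : ℕ) :
    ∃ ψ : Fin r → MvPowerSeries (Fin r) ℂ, (∀ i, MvPowerSeries.constantCoeff (ψ i) = 0) ∧
      (∀ i, ψ i * (if i = j then (1 + MvPowerSeries.C c * MvPowerSeries.subst ψ q) ^ w else 1) =
          MvPowerSeries.X i) ∧
      IsQOParam n lam (MvPowerSeries.subst ψ (S * (1 + MvPowerSeries.C c * q) ^ k)) ∧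
      ATildeEquiv n lam (param n S)
        (param n (MvPowerSeries.subst ψ (S * (1 + MvPowerSeries.C c * q) ^ k))) := by
  have hS0 := (isQOParam_iff.1 hS).2.1
  have hp := MvPowerSeries.hasSubst_of_constantCoeff_zero (constantCoeff_param (n := n) hS0)
  have hh0 : MvPowerSeries.constantCoeff h = 0 := by
    rw [← constantCoeff_subst_of_constantCoeff_zero (constantCoeff_param (n := n) hS0), ← hq]
    exact hγ.constantCoeff_eq_zero hγ0
  have hs : ∀ {l : ℕ} {ψ : Fin l → MvPowerSeries (Fin r) ℂ} (_ : MvPowerSeries.HasSubst ψ) f,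
      MvPowerSeries.subst ψ (1 + MvPowerSeries.C c * f) =
        1 + MvPowerSeries.C c * MvPowerSeries.subst ψ f := by
    intro l ψ hψ f
    rw [MvPowerSeries.subst_add hψ, MvPowerSeries.subst_mul hψ, MvPowerSeries.subst_C,
      ← MvPowerSeries.substAlgHom_apply hψ 1, map_one]
  obtain ⟨ψ, h1, h2, h3⟩ := exists_aTildeEquiv_param hS
    (isConvergent_one.add ((isConvergent_C c).mul hc)) (by simp [hh0]) j w k
  rw [hs hp, ← hq] at h3
  refine ⟨ψ, h1, ?_, h3⟩
  rwa [hs hp, ← hq, hs (MvPowerSeries.hasSubst_of_constantCoeff_zero h1)] at h2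

/-- The case where `S` is a monomial times a unit. -/
theorem isEliminable_of_eq_monomial_mul (j : Fin r) (hS : IsQOParam n lam S) {δ γ : Fin r →₀ ℕ}
    {u : MvPowerSeries (Fin r) ℂ} (hSu : S = MvPowerSeries.monomial δ (1 : ℂ) * u)
    (hu : MvPowerSeries.constantCoeff u ≠ 0) {h : MvPowerSeries (Fin (r + 1)) ℂ}
    (hc : IsConvergent h) (hγ : IsMonomialUnit γ (MvPowerSeries.subst (param n S) h))
    (hγ0 : γ ≠ 0) : IsEliminable n lam S (δ + γ) := by
  obtain ⟨q, hq⟩ : ∃ q, q = MvPowerSeries.subst (param n S) h := ⟨_, rfl⟩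
  rw [← hq] at hγ
  set u₀ := MvPowerSeries.constantCoeff u with hu₀
  set v := MvPowerSeries.coeff γ q with hv
  have hv0 : v ≠ 0 := (isMonomialUnit_iff.1 hγ).1
  -- The coefficient of `u (1 + c q)` at `γ` is that of `u` plus `c u₀ v`.
  set c : ℂ := -(MvPowerSeries.coeff γ u) / (u₀ * v) with hcdef
  obtain ⟨ψ, -, hψ, hqo, heq⟩ := exists_aTildeEquiv_of_isMonomialUnit hS hc hq hγ hγ0 c j 0 1
  -- With `w = 0` the source is unchanged and the choice of `j` is immaterial.
  have hψX : ψ = MvPowerSeries.X := by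
    ext1 i
    simpa using hψ i
  rw [hψX, MvPowerSeries.subst_self, id, pow_one] at hqo heq
  refine IsEliminable.of_congr (M := 0) (b := 1) (u := u) (e := c * (u₀ * v))
    (W := u * (1 + MvPowerSeries.C c * q)) (by rw [zero_add, hSu]) ?_ (map_zero _) ?_ ?_ hqo heq
  · rw [hSu, zero_add, mul_assoc]
  · have h1 := Ideal.mul_mem_left _ (MvPowerSeries.C c) (mul_sub_mem_vanishIdeal (g := u) hγ)
    have h2 := Ideal.mul_mem_left _ (MvPowerSeries.C (c * u₀)) hγ.sub_mem_vanishIdeal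
    have h3 : MvPowerSeries.monomial γ (c * (u₀ * v)) =
        MvPowerSeries.C (c * u₀) * MvPowerSeries.monomial γ v := by
      rw [← MvPowerSeries.monomial_zero_eq_C_apply, MvPowerSeries.monomial_mul_monomial, zero_add,
        mul_assoc]
    convert add_mem h1 h2 using 1
    rw [h3, map_mul]
    ring
  · rw [hcdef]
    field_simp
    ring

theorem finsuppProd_X_mul_ite (j : Fin r) (f : MvPowerSeries (Fin r) ℂ) (m : Fin r →₀ ℕ) :
    (m.prod fun i k => (MvPowerSeries.X i * if i = j then f else 1) ^ k) =
      MvPowerSeries.monomial m (1 : ℂ) * f ^ m j := by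
  simp_rw [mul_pow]
  rw [Finsupp.prod_mul, ← MvPowerSeries.monomial_one_eq,
    Finsupp.prod_fintype (g := fun i k => (if i = j then f else 1) ^ k) _ fun i => pow_zero _]
  simp [ite_pow]

theorem one_add_pow_of_sq_eq_zero {R : Type*} [CommRing R] {y : R} (hy : y * y = 0) (k : ℕ) :
    (1 + y) ^ k = 1 + k * y := by
  induction k with
  | zero => simp
  | succ k ih =>
    rw [pow_succ, ih]
    push_cast
    linear_combination (k : R) * hy

/-- Writing `Q` for the transported `1 + c q`, the inverse change multiplies `t^m` by `Q^(-m j)`.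
The factor `Q^(lam j)` restores `t^lam` and leaves `Q^(lam j - δ j)` on `t^δ`, a nontrivial power
because `lam j ≠ δ j`. -/
theorem isEliminable_of_ne (hS : IsQOParam n lam S) {δ γ : Fin r →₀ ℕ} {a : ℂ}
    {u : MvPowerSeries (Fin r) ℂ}
    (hSu : S = MvPowerSeries.monomial lam (1 : ℂ) + MvPowerSeries.monomial δ a * u)
    (hu : MvPowerSeries.constantCoeff u = 1) (hlam : lam ≠ δ + γ) (hδ : lam ≠ δ)
    {h : MvPowerSeries (Fin (r + 1)) ℂ}
    (hc : IsConvergent h) (hγ : IsMonomialUnit γ (MvPowerSeries.subst (param n S) h))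
    (hγ0 : γ ≠ 0) : IsEliminable n lam S (δ + γ) := by
  obtain ⟨q, hq⟩ : ∃ q, q = MvPowerSeries.subst (param n S) h := ⟨_, rfl⟩
  rw [← hq] at hγ
  obtain ⟨j, hj⟩ : ∃ j, lam j ≠ δ j := by
    by_contra! hne
    exact hδ (Finsupp.ext hne)
  set v := MvPowerSeries.coeff γ q with hv
  have hv0 : v ≠ 0 := (isMonomialUnit_iff.1 hγ).1
  have hj0 : ((lam j : ℂ) - δ j) ≠ 0 := sub_ne_zero.2 (by exact_mod_cast hj)
  set c : ℂ := -(MvPowerSeries.coeff γ u) / (((lam j : ℂ) - δ j) * v) with hcdef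
  obtain ⟨ψ, hψ0, hψ, hqo, heq⟩ :=
    exists_aTildeEquiv_of_isMonomialUnit hS hc hq hγ hγ0 c j 1 (lam j)
  have sψ := MvPowerSeries.hasSubst_of_constantCoeff_zero hψ0
  set q' := MvPowerSeries.subst ψ q with hq'
  have hq'0 : MvPowerSeries.constantCoeff q' = 0 := by
    rw [hq', constantCoeff_subst_of_constantCoeff_zero hψ0]
    exact hγ.constantCoeff_eq_zero hγ0
  set Q := 1 + MvPowerSeries.C c * q' with hQ
  have hQ0 : MvPowerSeries.constantCoeff Q = 1 := by simp [hQ, hq'0]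
  have hQinv : Q * Q⁻¹ = 1 :=
    MvPowerSeries.mul_inv_cancel _ (by rw [hQ0]; exact one_ne_zero)
  have hψe : ∀ i, ψ i = MvPowerSeries.X i * if i = j then Q⁻¹ else 1 := by
    intro i
    rw [← hψ i]
    split_ifs with hij
    · rw [pow_one, mul_assoc, hQinv, mul_one]
    · rw [mul_one, mul_one]
  have hq'γ : IsMonomialUnit γ q' := by
    refine hγ.subst hψe fun i => ?_
    split_ifs
    · rw [MvPowerSeries.constantCoeff_inv, hQ0, inv_one]
      exact one_ne_zero
    · rw [map_one]
      exact one_ne_zero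
  let φ := Ideal.Quotient.mk (vanishIdeal (notAbove γ))
  have hψX : ∀ i, ψ i - MvPowerSeries.X i ∈ vanishIdeal (notAbove γ) := by
    intro i
    rw [hψe]
    split_ifs with hij
    · have h1 : MvPowerSeries.X i * Q⁻¹ - MvPowerSeries.X i =
          q' * (-(MvPowerSeries.C c * MvPowerSeries.X i * Q⁻¹)) := by
        have h2 : Q⁻¹ = 1 - MvPowerSeries.C c * q' * Q⁻¹ := by
          rw [← hQinv, hQ]
          ring
        conv_lhs => rw [h2]
        ring
      rw [h1]
      exact mul_mem_vanishIdeal_of_constantCoeff hq'γ (by simp)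
    · rw [mul_one, sub_self]
      exact zero_mem _
  have hφψ : ∀ f, φ (MvPowerSeries.subst ψ f) = φ f := by
    intro f
    refine Ideal.Quotient.eq.2 ?_
    have h1 := subst_sub_subst_mem_vanishIdeal sψ MvPowerSeries.HasSubst.X hψX f
    rwa [MvPowerSeries.subst_self] at h1
  set y := φ (MvPowerSeries.C c * q') with hy
  -- Modulo exponents strictly above `γ`, `y` is a dual number: `y² = 0`, and `y u = y` because
  -- `u(0) = 1`. Powers of `Q` thus become linear in `y`.
  have hyy : y * y = 0 := by
    rw [hy, ← map_mul, Ideal.Quotient.eq_zero_iff_mem]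
    convert mul_mem_vanishIdeal_of_constantCoeff hq'γ
      (g := MvPowerSeries.C c * (MvPowerSeries.C c * q')) (by simp [hq'0]) using 1
    ring
  have hyu : y * φ u = y := by
    rw [hy, ← map_mul, Ideal.Quotient.eq]
    convert Ideal.mul_mem_left _ (MvPowerSeries.C c) (mul_sub_mem_vanishIdeal (g := u) hq'γ) using 1
    rw [hu, map_one]
    ring
  have hyv : y = φ (MvPowerSeries.monomial γ (c * v)) := by
    have h1 : MvPowerSeries.monomial γ (c * v) =
        MvPowerSeries.C c * MvPowerSeries.monomial γ v := by
      rw [← MvPowerSeries.monomial_zero_eq_C_apply, MvPowerSeries.monomial_mul_monomial, zero_add]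
    rw [hy, h1, map_mul, map_mul, hq', hφψ]
    congr 1
    exact Ideal.Quotient.eq.2 hγ.sub_mem_vanishIdeal
  have hφQ : φ Q = 1 + y := by rw [hQ, map_add, map_one]
  have hφQinv : φ Q⁻¹ = 1 + -y := by
    have h1 : φ Q * φ Q⁻¹ = 1 := by rw [← map_mul, hQinv, map_one]
    rw [hφQ] at h1
    linear_combination (1 - y) * h1 + φ Q⁻¹ * hyy
  -- The new cofactor of `a t^δ`. In the quotient `ψ` acts trivially, so it is `(1 - δ_j y)(1 +
  -- lam_j y) u = u + (lam_j - δ_j) y`.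
  let W := Q⁻¹ ^ δ j * Q ^ lam j * MvPowerSeries.subst ψ u
  have hsubst : ∀ (m : Fin r →₀ ℕ) (b : ℂ), MvPowerSeries.subst ψ (MvPowerSeries.monomial m b) =
      MvPowerSeries.monomial m b * Q⁻¹ ^ m j := by
    intro m b
    rw [MvPowerSeries.subst_monomial sψ]
    simp_rw [hψe]
    rw [finsuppProd_X_mul_ite, ← mul_assoc, MvPowerSeries.algebraMap_apply,
      ← MvPowerSeries.monomial_zero_eq_C_apply, MvPowerSeries.monomial_mul_monomial, zero_add,
      mul_one]
    rfl
  have hS'W : MvPowerSeries.subst ψ (S * (1 + MvPowerSeries.C c * q) ^ lam j) =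
      MvPowerSeries.monomial lam (1 : ℂ) + MvPowerSeries.monomial δ a * W := by
    have h1 : MvPowerSeries.subst ψ (1 + MvPowerSeries.C c * q) = Q := by
      rw [MvPowerSeries.subst_add sψ, MvPowerSeries.subst_mul sψ, MvPowerSeries.subst_C,
        ← MvPowerSeries.substAlgHom_apply sψ 1, map_one]
    have h2 : Q ^ lam j * Q⁻¹ ^ lam j = 1 := by rw [← mul_pow, hQinv, one_pow]
    rw [MvPowerSeries.subst_mul sψ, MvPowerSeries.subst_pow sψ, h1, hSu,
      MvPowerSeries.subst_add sψ, MvPowerSeries.subst_mul sψ, hsubst, hsubst]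
    simp only [W]
    linear_combination MvPowerSeries.monomial lam (1 : ℂ) * h2
  refine IsEliminable.of_congr (e := ((lam j : ℂ) - δ j) * (c * v)) hSu hS'W
    (MvPowerSeries.coeff_monomial_ne hlam.symm _) ?_ ?_ hqo heq
  · have h1 : MvPowerSeries.monomial γ (((lam j : ℂ) - δ j) * (c * v)) =
        ((lam j : MvPowerSeries (Fin r) ℂ) - (δ j : MvPowerSeries (Fin r) ℂ)) *
          MvPowerSeries.monomial γ (c * v) := by
      rw [← map_natCast (MvPowerSeries.C (σ := Fin r) (R := ℂ)) (lam j),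
        ← map_natCast (MvPowerSeries.C (σ := Fin r) (R := ℂ)) (δ j), ← map_sub,
        ← MvPowerSeries.monomial_zero_eq_C_apply, MvPowerSeries.monomial_mul_monomial, zero_add]
    rw [← Ideal.Quotient.eq]
    change φ W = φ _
    rw [h1, map_add φ, map_mul φ (_ - _), ← hyv, map_sub, map_natCast, map_natCast]
    simp only [W]
    rw [map_mul, map_mul, map_pow, map_pow, hφψ, hφQ, hφQinv, one_add_pow_of_sq_eq_zero hyy,
      one_add_pow_of_sq_eq_zero (by linear_combination hyy)]
    linear_combination ((lam j : _ ⧸ vanishIdeal (notAbove γ)) - δ j) * hyu -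
      (lam j : _ ⧸ vanishIdeal (notAbove γ)) * δ j * φ u * hyy
  · rw [hcdef]
    field_simp
    ring

end lam

end QuasiOrdinary

theorem mainTheorem5 (n : ℕ) (lam δ : Fin 2 →₀ ℕ) (a : ℂ) (ha : a ≠ 0)
    (u : MvPowerSeries (Fin 2) ℂ) (hu : QuasiOrdinary.IsConvergent u)
    (hu0 : MvPowerSeries.constantCoeff u = 1) (S : MvPowerSeries (Fin 2) ℂ)
    (hS : S = MvPowerSeries.monomial lam (1 : ℂ) + MvPowerSeries.monomial δ a * u)
    (hH : QuasiOrdinary.IsQOParam n lam S) (γ : Fin 2 →₀ ℕ)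
    (hγ : γ ∈ QuasiOrdinary.assocSemigroup n S) (hγ0 : γ ≠ 0) :
    QuasiOrdinary.IsEliminable n lam S (δ + γ) := by
  -- A monic polynomial of degree 0 is 1, which is not irreducible.
  have hn : NeZero n := ⟨by
    rintro rfl
    obtain ⟨f, hf, -⟩ := hH
    have h1 := Polynomial.eq_one_of_monic_natDegree_zero hf.monic hf.natDegree_eq
    exact hf.irreducible.not_isUnit (h1 ▸ isUnit_one)⟩
  obtain ⟨h, hc, hdom⟩ := hγ
  have hq := hdom.isMonomialUnit
  by_cases hδ : lam = δ
  · subst hδ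
    have hSu : S = MvPowerSeries.monomial lam (1 : ℂ) * (1 + MvPowerSeries.C a * u) := by
      rw [hS, mul_add, mul_one, ← mul_assoc, ← MvPowerSeries.monomial_zero_eq_C_apply,
        MvPowerSeries.monomial_mul_monomial, add_zero, one_mul]
    refine QuasiOrdinary.isEliminable_of_eq_monomial_mul 0 hH hSu ?_ hc hq hγ0
    -- The factor `1 + a u` is a unit because the term `t^lam` cannot cancel: `lam` is the exponent
    -- of a difference of conjugates, so `S` has a term there.
    have h1 := QuasiOrdinary.coeff_lam_ne_zero hH
    rwa [hSu, MvPowerSeries.coeff_monomial_mul, if_pos le_rfl, tsub_self, one_mul] at h1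
  · refine QuasiOrdinary.isEliminable_of_ne hH hS hu0 ?_ hδ hc hq hγ0
    refine QuasiOrdinary.lam_ne_add hH ?_ hq hγ0
    rw [hS, map_add, MvPowerSeries.coeff_monomial_ne (Ne.symm hδ), MvPowerSeries.coeff_monomial_mul,
      if_pos le_rfl, tsub_self, zero_add, MvPowerSeries.coeff_zero_eq_constantCoeff_apply, hu0,
      mul_one]
    exact ha
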